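/- **Setup.** Let \(\operatorname{Im}\tau>0\), \(q=e^{2\pi i\tau}\), and for \(x=e^{2\pi i u}\), \(x^{1/2}=e^{\pi i u}\), put \[\vartheta(x)=(x^{1/2}-x^{-1/2})\prod_{s\ge 0}(1-q^{s+1}x)(1-q^{s+1}/x),\] a function of \(u\). All variables \(z_a,h,\mu_j,t^{(k)}_a\) below are likewise understood through chosen logarithms (i.e. on the universal cover of the torus), which fix all products and powers of them. Let \(N,n\ge 0\), \(\lambda\in\mathbb Z_{\ge0}^N\) with \(\lambda_1+\dots+\lambda_N=n\), \(\lambda^{(k)}=\lambda_1+\dots+\lambda_k\), \(\lambda^{\{1\}}=\lambda^{(1)}+\dots+\lambda^{(N-1)}\). Let \(\mathcal I_\lambda\) be the set of partitions \(I=(I_1,\dots,I_N)\) of \(\{1,\dots,n\}\) into labelled, possibly empty blocks with \(|I_k|=\lambda_k\). For \(I\in\mathcal I_\lambda\) write \(I_1\cup\dots\cup I_k=\{i^{(k)}_1<\dots<i^{(k)}_{\lambda^{(k)}}\}\), let \(j(I,k,a)\) be the index with \(i^{(k)}_a\in I_{j(I,k,a)}\), and \(p_{I,j}(m)=|I_j\cap\{1,\dots,m-1\}|\).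 For \(1\le k\le N-1\), \(1\le a\le\lambda^{(k)}\) set \[d_{I,k,a}(h,\mu)=h^{\,1+p_{I,j(I,k,a)}(i^{(k)}_a)-p_{I,k+1}(i^{(k)}_a)}\,\mu_{k+1}/\mu_{j(I,k,a)},\qquad \psi_I(h,\mu)=\prod_{k=1}^{N-1}\prod_{a=1}^{\lambda^{(k)}}\vartheta(d_{I,k,a}(h,\mu)).\] With variables \(t=(t^{(k)}_a)_{1\le k\le N-1,\,1\le a\le\lambda^{(k)}}\) and \(t^{(N)}_a=z_a\), put \[U_I(t,z,h,\mu)=\prod_{k=1}^{N-1}\prod_{a=1}^{\lambda^{(k)}}\Bigl(\prod_{c=1}^{\lambda^{(k+1)}}\psi_{I,k,a,c}\bigl(t^{(k+1)}_c/t^{(k)}_a\bigr)\prod_{b=a+1}^{\lambda^{(k)}}\frac{\vartheta(h\,t^{(k)}_b/t^{(k)}_a)}{\vartheta(t^{(k)}_b/t^{(k)}_a)}\Bigr),\] where \(\psi_{I,k,a,c}(x)\) equals \(\vartheta(hx)\) if \(i^{(k+1)}_c<i^{(k)}_a\), \(\vartheta(x\,d_{I,k,a}(h,\mu))/\vartheta(d_{I,k,a}(h,\mu))\)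 if \(i^{(k+1)}_c=i^{(k)}_a\), and \(\vartheta(x)\) if \(i^{(k+1)}_c>i^{(k)}_a\). The elliptic weight functions are \[W^{ell}_I(t,z,h,\mu)=\vartheta(h)^{\lambda^{\{1\}}}\operatorname{Sym}_{t^{(1)}}\cdots\operatorname{Sym}_{t^{(N-1)}}U_I(t,z,h,\mu),\] \[W^{ell}_{\sigma,I}(t,z,h,\mu)=W^{ell}_{\sigma^{-1}(I)}(t,z_{\sigma(1)},\dots,z_{\sigma(n)},h,\mu),\qquad \widetilde W^{ell}_{\sigma,I}(t,z,h,\mu)=\frac{W^{ell}_{\sigma,I}(t,z,h,\mu)}{\prod_{k=1}^{N-1}\prod_{a,b=1}^{\lambda^{(k)}}\vartheta(h\,t^{(k)}_b/t^{(k)}_a)},\] where \(\sigma\in S_n\), \(\sigma^{-1}(I)=(\sigma^{-1}(I_1),\dots,\sigma^{-1}(I_N))\), and \(\operatorname{Sym}_{t^{(k)}}\) is the sum over all permutations of \(t^{(k)}_1,\dots,t^{(k)}_{\lambda^{(k)}}\). Let \(z_I\) denote the substitution \(t^{(k)}_a=z_{i^{(k)}_a}\) (\(1\le k\le N-1\)),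 let \(\sigma_0\in S_n\) be the longest permutation, let \(h^\lambda\mu^{-1}=(h^{\lambda_1}\mu_1^{-1},\dots,h^{\lambda_N}\mu_N^{-1})\), and \[R^{ell}(z_I)=\prod_{k<l}\prod_{a\in I_k}\prod_{b\in I_l}\vartheta(z_b/z_a),\qquad Q^{ell}(z_I,h)=\prod_{k<l}\prod_{a\in I_k}\prod_{b\in I_l}\vartheta(h z_b/z_a).\] **Theorem 2.9.** Let \(J,K\in\mathcal I_\lambda\), and let \(z,h,\mu\) be such that \(\vartheta(z_b/z_a)\ne0\) for all \(a\neq b\), \(\vartheta(hz_b/z_a)\neq0\) for all \(a,b\) (including \(a=b\)), \(\psi_J(h,\mu)\ne0\) and \(\psi_{\sigma_0^{-1}(K)}(h,h^\lambda\mu^{-1})\neq0\). Then \[\sum_{I\in\mathcal I_\lambda}\frac{\widetilde W^{ell}_{\mathrm{id},J}(z_I,z,h,\mu)\;\widetilde W^{ell}_{\sigma_0,K}(z_I,z,h,h^\lambda\mu^{-1})}{R^{ell}(z_I)\,Q^{ell}(z_I,h)}=\delta_{J,K}.\] -/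

import Mathlib

/-!
Elliptic weight functions for `gl_N`.

The function `ϑ(x)` contains `x ^ (1/2)`, so everything lives on the universal cover of the
multiplicative torus.  Accordingly all variables are written in additive coordinates:
`q = exp (2πi τ)`, `h = exp (2πi η)`, `μ_j = exp (2πi ν_j)`, and likewise the variables called
`z` and `t` below are the additive coordinates of `z` and `t`.  A value `ϑ(x)` with `x = exp (2πi u)` is `theta τ u`, and
products and quotients of the multiplicative variables become sums and differences.

Indices start from zero: the block `I_j` of a partition, `j = 1, …, N`, is the block with
index `j - 1 : Fin N`, and the set `{1, …, n}` is `Fin n`.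
-/

noncomputable section

open Finset

namespace EllipticWeight

/-- `∏_{s ≥ 0} (1 - q ^ s x)`. -/
def phiProd (q x : ℂ) : ℂ := ∏' s : ℕ, (1 - q ^ s * x)

/-- For `|q| < 1` the infinite product defining `phiProd` converges. -/
theorem multipliable_phiProd {q : ℂ} (hq : ‖q‖ < 1) (x : ℂ) :
    Multipliable fun s : ℕ => (1 - q ^ s * x) := by
  have h : Summable fun s : ℕ => ‖-(q ^ s * x)‖ := by
    simpa [norm_mul, norm_pow] using
      (summable_geometric_of_lt_one (norm_nonneg q) hq).mul_right ‖x‖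
  simpa [sub_eq_add_neg] using multipliable_one_add_of_summable h

/-- `θ(u, τ) = (x^{1/2} - x^{-1/2}) φ(q x) φ(q / x)`, where `x = exp (2πi u)`,
`x^{1/2} = exp (πi u)`, `q = exp (2πi τ)`. -/
def theta (τ u : ℂ) : ℂ :=
  let x : ℂ := Complex.exp (2 * Real.pi * Complex.I * u)
  let q : ℂ := Complex.exp (2 * Real.pi * Complex.I * τ)
  (Complex.exp (Real.pi * Complex.I * u) - Complex.exp (-(Real.pi * Complex.I * u))) *
    phiProd q (q * x) * phiProd q (q / x)

variable {N : ℕ}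

/-- The partial sum `lam^{(m)} = lam_1 + … + lam_m`. -/
def cum (lam : Fin N → ℕ) (m : ℕ) : ℕ := ∑ j : Fin N with j.val < m, lam j

/-- The number `n = lam_1 + … + lam_N`. -/
abbrev total (lam : Fin N → ℕ) : ℕ := ∑ j, lam j

theorem cum_le (lam : Fin N → ℕ) (m : ℕ) : cum lam m ≤ total lam :=
  Finset.sum_le_sum_of_subset (Finset.filter_subset _ _)

/-- The set of partitions `I = (I_1, …, I_N)` of `{1, …, n}` with `|I_j| = lam_j`.
A partition into `N` labelled (possibly empty) blocks is recorded by the map that sends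
`a` to the label `j` of the block `I_j` containing `a`. -/
abbrev Part (lam : Fin N → ℕ) : Type :=
  {c : Fin (total lam) → Fin N // ∀ j, #{a | c a = j} = lam j}

variable {lam : Fin N → ℕ}

/-- The block `I_j`. -/
def block (I : Part lam) (j : Fin N) : Finset (Fin (total lam)) := {a | I.1 a = j}

/-- The union `I_1 ∪ … ∪ I_m`. -/
def blocksUpTo (I : Part lam) (m : ℕ) : Finset (Fin (total lam)) := {a | (I.1 a).val < m}

theorem card_blocksUpTo (I : Part lam) (m : ℕ) : #(blocksUpTo I m) = cum lam m := by
  have h := Finset.card_eq_sum_card_fiberwise (s := blocksUpTo I m)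
    (t := ({j : Fin N | j.val < m} : Finset (Fin N))) (f := I.1) (by
      intro a ha
      simpa [blocksUpTo] using ha)
  rw [h, cum]
  refine Finset.sum_congr rfl fun j hj => ?_
  rw [← I.2 j]
  congr 1
  ext a
  simp only [blocksUpTo, Finset.mem_filter, Finset.mem_univ, true_and] at hj ⊢
  constructor
  · exact fun h => h.2
  · rintro rfl
    exact ⟨hj, rfl⟩

/-- `elt I m` is the increasing enumeration `i^{(m)}_1 < … < i^{(m)}_{lam^{(m)}}` of
`I_1 ∪ … ∪ I_m`. -/
def elt (I : Part lam) (m : ℕ) : Fin (cum lam m) ↪o Fin (total lam) :=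
  (blocksUpTo I m).orderEmbOfFin (card_blocksUpTo I m)

/-- `p_{I,j}(i) = |I_j ∩ {1, …, i - 1}|`. -/
def pcount (I : Part lam) (j : Fin N) (i : Fin (total lam)) : ℕ := #{b ∈ block I j | b < i}

/-- The partition `σ⁻¹(I) = (σ⁻¹(I_1), …, σ⁻¹(I_N))`: `a ∈ σ⁻¹(I_j)` iff `σ a ∈ I_j`. -/
def permInv (σ : Equiv.Perm (Fin (total lam))) (I : Part lam) : Part lam :=
  ⟨fun a => I.1 (σ a), fun j => by
    rw [← I.2 j]
    exact Finset.card_equiv σ (by simp)⟩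

/-- The variables `t = (t^{(1)}, …, t^{(N-1)})`, `t^{(m)} = (t^{(m)}_a)_{a ≤ lam^{(m)}}`.
The entry at `k : Fin (N - 1)` is `t^{(m)}` with `m = k + 1`. -/
abbrev TVar (lam : Fin N → ℕ) : Type := (k : Fin (N - 1)) → Fin (cum lam (k + 1)) → ℂ

/-- `nextVar t z k` is the family `t^{(m+1)}` for `m = k + 1`, with `t^{(N)} = z`. -/
def nextVar (t : TVar lam) (z : Fin (total lam) → ℂ) (k : Fin (N - 1))
    (c : Fin (cum lam (k + 2))) : ℂ :=
  if hk : k.val + 1 < N - 1 then t ⟨k.val + 1, hk⟩ c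
  else z (Fin.castLE (cum_le lam (k + 2)) c)

/-- The label `m + 1` of a block, where `m = k + 1` (labels start from zero in `Fin N`). -/
def nextLabel (k : Fin (N - 1)) : Fin N := ⟨k.val + 1, by omega⟩

/-- The additive coordinate of
`h ^ (1 + p_{I,j}(i^{(m)}_a) - p_{I,m+1}(i^{(m)}_a)) μ_{m+1} / μ_j`, where `m = k + 1` and
`j` is such that `i^{(m)}_a ∈ I_j`. -/
def dynArg (I : Part lam) (η : ℂ) (ν : Fin N → ℂ) (k : Fin (N - 1))
    (a : Fin (cum lam (k + 1))) : ℂ :=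
  (1 + (pcount I (I.1 (elt I (k + 1) a)) (elt I (k + 1) a) : ℂ)
      - (pcount I (nextLabel k) (elt I (k + 1) a) : ℂ)) * η
    + ν (nextLabel k) - ν (I.1 (elt I (k + 1) a))

/-- The function `ψ_{I,m,a,c}(x)` at `x = exp (2πi u)`, where `m = k + 1`. -/
def psi (τ : ℂ) (I : Part lam) (η : ℂ) (ν : Fin N → ℂ) (k : Fin (N - 1))
    (a : Fin (cum lam (k + 1))) (c : Fin (cum lam (k + 2))) (u : ℂ) : ℂ :=
  if elt I (k + 2) c < elt I (k + 1) a then theta τ (η + u)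
  else if elt I (k + 2) c = elt I (k + 1) a then
    theta τ (u + dynArg I η ν k a) / theta τ (dynArg I η ν k a)
  else theta τ u

/-- The product `ψ_I(h, μ)` of all denominators of `U_I` depending on `h, μ` only. -/
def psiDenom (τ : ℂ) (I : Part lam) (η : ℂ) (ν : Fin N → ℂ) : ℂ :=
  ∏ k : Fin (N - 1), ∏ a : Fin (cum lam (k + 1)), theta τ (dynArg I η ν k a)

/-- The function `U_I(t, z, h, μ)`. -/
def U (τ : ℂ) (I : Part lam) (t : TVar lam) (z : Fin (total lam) → ℂ) (η : ℂ)
    (ν : Fin N → ℂ) : ℂ :=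
  ∏ k : Fin (N - 1), ∏ a : Fin (cum lam (k + 1)),
    ((∏ c : Fin (cum lam (k + 2)), psi τ I η ν k a c (nextVar t z k c - t k a)) *
      ∏ b : Fin (cum lam (k + 1)) with a < b,
        theta τ (η + t k b - t k a) / theta τ (t k b - t k a))

/-- The elliptic weight function
`W_I(t, z, h, μ) = ϑ(h) ^ {lam^{(1)} + … + lam^{(N-1)}} Sym_{t^{(1)}} … Sym_{t^{(N-1)}} U_I`.
The iterated symmetrization is the sum over all families `s = (s_1, …, s_{N-1})` of permutations
`s_m` of the variables `t^{(m)}`. -/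
def W (τ : ℂ) (I : Part lam) (t : TVar lam) (z : Fin (total lam) → ℂ) (η : ℂ)
    (ν : Fin N → ℂ) : ℂ :=
  theta τ η ^ (∑ k : Fin (N - 1), cum lam (k + 1)) *
    ∑ s : (k : Fin (N - 1)) → Equiv.Perm (Fin (cum lam (k + 1))),
      U τ I (fun k a => t k (s k a)) z η ν

/-- `W_{σ,I}(t, z, h, μ) = W_{σ⁻¹(I)}(t, z_{σ(1)}, …, z_{σ(n)}, h, μ)`. -/
def Wperm (τ : ℂ) (σ : Equiv.Perm (Fin (total lam))) (I : Part lam) (t : TVar lam)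
    (z : Fin (total lam) → ℂ) (η : ℂ) (ν : Fin N → ℂ) : ℂ :=
  W τ (permInv σ I) t (fun a => z (σ a)) η ν

/-- `E_lam(t, h) = ∏_{m=1}^{N-1} ∏_{a,b ≤ lam^{(m)}} ϑ(h t^{(m)}_b / t^{(m)}_a)`. -/
def E (τ : ℂ) (t : TVar lam) (η : ℂ) : ℂ :=
  ∏ k : Fin (N - 1), ∏ a : Fin (cum lam (k + 1)), ∏ b : Fin (cum lam (k + 1)),
    theta τ (η + t k b - t k a)

/-- The normalized weight function `W̃_{σ,I} = W_{σ,I} / E_lam`. -/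
def Wtilde (τ : ℂ) (σ : Equiv.Perm (Fin (total lam))) (I : Part lam) (t : TVar lam)
    (z : Fin (total lam) → ℂ) (η : ℂ) (ν : Fin N → ℂ) : ℂ :=
  Wperm τ σ I t z η ν / E τ t η

/-- The substitution `z_I`: `t^{(m)}_a = z_{i^{(m)}_a}`. -/
def zSub (z : Fin (total lam) → ℂ) (I : Part lam) : TVar lam :=
  fun k a => z (elt I (k + 1) a)

/-- `R(z_I) = ∏_{k<l} ∏_{a ∈ I_k} ∏_{b ∈ I_l} ϑ(z_b / z_a)`. -/
def R (τ : ℂ) (z : Fin (total lam) → ℂ) (I : Part lam) : ℂ :=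
  ∏ k : Fin N, ∏ l : Fin N with k < l, ∏ a ∈ block I k, ∏ b ∈ block I l,
    theta τ (z b - z a)

/-- `Q(z_I, h) = ∏_{k<l} ∏_{a ∈ I_k} ∏_{b ∈ I_l} ϑ(h z_b / z_a)`. -/
def Q (τ : ℂ) (z : Fin (total lam) → ℂ) (η : ℂ) (I : Part lam) : ℂ :=
  ∏ k : Fin N, ∏ l : Fin N with k < l, ∏ a ∈ block I k, ∏ b ∈ block I l,
    theta τ (η + z b - z a)

/-- The additive coordinates of `h^lam μ⁻¹ = (h^{lam_1} μ_1⁻¹, …, h^{lam_N} μ_N⁻¹)`. -/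
def dualDyn (lam : Fin N → ℕ) (η : ℂ) (ν : Fin N → ℂ) : Fin N → ℂ :=
  fun j => (lam j : ℂ) * η - ν j

end EllipticWeight

end

/-!
The orthogonality relation is proved by letting neighbouring elements of `{1, …, n}` trade places.

*The theta function.* By the Jacobi triple product (`exists_triple_product`), `ϑ` is a Jacobi theta
series.  Splitting a product of two such series by the parity of the sum of the two summation
indices (`jacobiTheta₂_mul`) shows that `ϑ(u + v) ϑ(u - v)` is an alternating form of rank two in
`u` and `v` (`exists_theta_mul_theta`), and the three-term identity `theta_three_term` is the Plücker
relation for this form.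

*The exchange relation.* A partition is encoded as a coloring `c` of its elements, and its weight
function is computed level by level (`weight`): level `m` carries the variables of the elements with
`c i < m`, and the variables of a level are summed over their assignments to these elements.  Let
`a < a'` be neighbours with `c a < c a'`.  Then the weight function of `c ∘ swap a a'` is
`α · W_c(… x, y …) + β · W_c(… y, x …)`, where `x, y` are the variables of `a, a'` at the top level
and `α`, `β` are the entries `alphaCoeff`, `betaCoeff` of a dynamical `R`-matrix
(`weight_exchange`).  The relation travels up the levels: at the first level where both elements
occur it is the three-term identity `single_exchange`, and `pairFactor_exchange` moves the
coefficients from the variables of one level to those of the next; all other factors depend only on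
the relative order of the elements and are not affected.  If `c a = c a'`, the weight function is
symmetric in `x, y` (`weight_symm`).

*The pairing.* Let `S(J, K; z)` be the left hand side of the orthogonality relation (`pairing`).
Reversing the order of the elements while passing to the dual parameters `h^λ μ⁻¹` turns the
dynamical variables into their negatives (`dynVar_dual`), so that the exchange relations for the two
factors have matching coefficients.  Together they express `S(s J, K; z)`, for `s` the exchange of
two neighbours, in terms of `S(J, K; z)`, `S(J, K; s z)` and `S(J, s K; s z)`
(`pairing_permInv_swap`).  Hence the orthogonality relation for `J` implies the one for `s J`, and it
remains to treat the partition into successive intervals.  There triangularity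
(`weight_valuesAt_top`) leaves only the term with `I = J`, which vanishes unless `K = J`, and this
term is explicit (`pairing_of_monotone`).

*Continuity.* The argument divides by theta functions of the dynamical parameters and so needs
generic parameters.  These are dense on a complex line through any `ν` (`dense_generic`), and both
sides are continuous along it where the denominators `ψ_J`, `ψ_K` do not vanish.
-/

noncomputable section

open Finset Filter Topology

namespace EllipticWeight

/-! ### The Jacobi triple product -/

/-- The finite `q`-Pochhammer symbol `(q; q)_m = ∏_{s=1}^m (1 - q ^ s)`. -/
def qPoch (q : ℂ) (m : ℕ) : ℂ := ∏ s ∈ range m, (1 - q ^ (s + 1))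

/-- The Gaussian binomial coefficient, extended by zero to `M < k`. -/
def qBinom (q : ℂ) (M k : ℕ) : ℂ :=
  if k ≤ M then qPoch q M / (qPoch q k * qPoch q (M - k)) else 0

lemma one_sub_pow_ne_zero {q : ℂ} (hq : ‖q‖ < 1) (s : ℕ) : 1 - q ^ (s + 1) ≠ 0 := by
  intro h
  have h1 : ‖q ^ (s + 1)‖ < 1 := by
    rw [norm_pow]; exact pow_lt_one₀ (norm_nonneg _) hq (by omega)
  rw [← sub_eq_zero.1 h] at h1
  simp at h1

lemma qPoch_ne_zero {q : ℂ} (hq : ‖q‖ < 1) (m : ℕ) : qPoch q m ≠ 0 :=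
  prod_ne_zero_iff.2 fun s _ => one_sub_pow_ne_zero hq s

lemma qPoch_succ (q : ℂ) (m : ℕ) : qPoch q (m + 1) = qPoch q m * (1 - q ^ (m + 1)) :=
  prod_range_succ _ _

lemma qBinom_zero_right {q : ℂ} (hq : ‖q‖ < 1) (M : ℕ) : qBinom q M 0 = 1 := by
  have := qPoch_ne_zero hq M
  rw [qBinom, if_pos (Nat.zero_le M), Nat.sub_zero, show qPoch q 0 = 1 from prod_range_zero _,
    one_mul, div_self this]

/-- The `q`-Pascal rule. -/
lemma qBinom_succ_succ {q : ℂ} (hq : ‖q‖ < 1) {M k : ℕ} (hk : k ≤ M) :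
    qBinom q (M + 1) (k + 1) = qBinom q M (k + 1) + q ^ (M - k) * qBinom q M k := by
  obtain ⟨d, rfl⟩ := Nat.exists_eq_add_of_le hk
  have h1 := qPoch_ne_zero hq k
  have h2 := qPoch_ne_zero hq d
  have h3 := one_sub_pow_ne_zero hq k
  rcases d with _ | d
  · have h4 := qPoch_ne_zero hq (k + 1)
    simp only [qBinom, add_zero, le_refl, if_true, Nat.sub_self, Nat.not_succ_le_self, if_false,
      pow_zero]
    simp only [qPoch, range_zero, prod_empty, mul_one] at *
    rw [div_self h4, div_self h1]; ring
  · have h4 := qPoch_ne_zero hq d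
    have h5 := one_sub_pow_ne_zero hq d
    have e1 : k + (d + 1) + 1 - (k + 1) = d + 1 := by omega
    have e2 : k + (d + 1) - (k + 1) = d := by omega
    have e3 : k + (d + 1) - k = d + 1 := by omega
    simp only [qBinom, e1, e2, e3]
    rw [if_pos (by omega), if_pos (by omega), if_pos (by omega), qPoch_succ q (k + (d + 1)),
      qPoch_succ q k, qPoch_succ q d]
    field_simp
    ring

/-- The `q`-binomial theorem. -/
theorem prod_one_sub_pow_mul {q : ℂ} (hq : ‖q‖ < 1) (M : ℕ) (X : ℂ) :
    ∏ s ∈ range M, (1 - q ^ s * X) =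
      ∑ k ∈ range (M + 1), (-1) ^ k * q ^ (k.choose 2) * qBinom q M k * X ^ k := by
  induction M with
  | zero => simp [qBinom_zero_right hq]
  | succ M ih =>
    have hlast : ∑ k ∈ range (M + 1), (-1) ^ k * q ^ (k.choose 2) * qBinom q M k * X ^ k =
        ∑ k ∈ range (M + 1 + 1), (-1) ^ k * q ^ (k.choose 2) * qBinom q M k * X ^ k := by
      rw [sum_range_succ _ (M + 1)]
      simp [qBinom]
    rw [prod_range_succ, ih, mul_sub, mul_one]
    nth_rewrite 1 [hlast]
    rw [sum_range_succ' _ (M + 1), sum_range_succ' _ (M + 1), sum_mul, add_sub_right_comm,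
      ← sum_sub_distrib]
    congr 1
    · refine sum_congr rfl fun k hk => ?_
      have hk' : k ≤ M := by simpa [Nat.lt_succ_iff] using hk
      have hc : (k + 1).choose 2 = k + k.choose 2 := by
        rw [Nat.choose_succ_succ' k 1, Nat.choose_one_right]
      rw [qBinom_succ_succ hq hk', hc]
      have : q ^ M = q ^ k * q ^ (M - k) := by rw [← pow_add]; congr 1; omega
      rw [this]; ring
    · simp [qBinom_zero_right hq]

lemma norm_nome_lt_one {τ : ℂ} (hτ : 0 < τ.im) :
    ‖Complex.exp (2 * Real.pi * Complex.I * τ)‖ < 1 := by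
  rw [Complex.norm_exp]
  have : (2 * (Real.pi : ℂ) * Complex.I * τ).re = -(2 * Real.pi * τ.im) := by
    simp [Complex.mul_re]
  rw [this, Real.exp_lt_one_iff]
  have := Real.pi_pos
  have : 0 < 2 * Real.pi * τ.im := by positivity
  linarith

open Complex in
/-- The finite form of the Jacobi triple product. -/
lemma finite_triple_product {τ : ℂ} (hτ : 0 < τ.im) (u : ℂ) (m : ℕ) :
    (∏ s ∈ range m, (1 - exp (2 * Real.pi * I * τ) ^ s * exp (2 * Real.pi * I * u))) *
      (∏ s ∈ range m, (1 - exp (2 * Real.pi * I * τ) ^ s *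
        (exp (2 * Real.pi * I * τ) / exp (2 * Real.pi * I * u)))) =
    ∑ k ∈ range (2 * m + 1), qBinom (exp (2 * Real.pi * I * τ)) (2 * m) k *
      jacobiTheta₂_term ((k : ℤ) - m) (u + 1 / 2 - τ / 2) τ := by
  set q := exp (2 * Real.pi * I * τ) with hqdef
  have hq : ‖q‖ < 1 := norm_nome_lt_one hτ
  set x := exp (2 * Real.pi * I * u) with hx
  have hq0 : q ≠ 0 := exp_ne_zero _
  have hx0 : x ≠ 0 := exp_ne_zero _
  have key := prod_one_sub_pow_mul hq (2 * m) (x / q ^ m)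
  rw [two_mul, prod_range_add] at key
  have h2 : ∏ s ∈ range m, (1 - q ^ (m + s) * (x / q ^ m)) =
      ∏ s ∈ range m, (1 - q ^ s * x) := by
    refine prod_congr rfl fun s _ => ?_
    rw [pow_add]; field_simp
  have h1 : ∏ s ∈ range m, (1 - q ^ s * (x / q ^ m)) =
      ((-x) ^ m / q ^ ((m + 1).choose 2)) * ∏ s ∈ range m, (1 - q ^ s * (q / x)) := by
    rw [← prod_range_reflect]
    clear key h2
    have hprod : ∀ m : ℕ, ∏ s ∈ range m, (-x / q ^ (s + 1)) =
        (-x) ^ m / q ^ ((m + 1).choose 2) := by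
      intro m
      induction m with
      | zero => simp
      | succ m ih =>
        have hc : (m + 1 + 1).choose 2 = m + 1 + (m + 1).choose 2 := by
          rw [Nat.choose_succ_succ' (m + 1) 1, Nat.choose_one_right]
        rw [prod_range_succ, ih, hc, pow_add, pow_succ (-x)]
        field_simp
        ring
    rw [← hprod, ← prod_mul_distrib]
    refine prod_congr rfl fun s hs => ?_
    have hs' : s < m := by simpa using hs
    obtain ⟨d, rfl⟩ := Nat.exists_eq_add_of_lt hs'
    have e : s + d + 1 - 1 - s = d := by omega
    rw [e, pow_add, pow_add]
    field_simp
    ring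
  rw [h1, h2] at key
  have hc : (-x) ^ m / q ^ ((m + 1).choose 2) ≠ 0 :=
    div_ne_zero (pow_ne_zero _ (neg_ne_zero.2 hx0)) (pow_ne_zero _ hq0)
  apply mul_left_cancel₀ hc
  rw [mul_comm (∏ s ∈ range m, (1 - q ^ s * x)), ← mul_assoc, key, mul_sum, two_mul]
  refine sum_congr rfl fun k _ => ?_
  have hchoose : ∀ k : ℕ, q ^ (k.choose 2) = exp (2 * Real.pi * I * τ * ((k : ℂ) * (k - 1) / 2)) := by
    intro k
    rw [hqdef, ← exp_nat_mul, Nat.cast_choose_two]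
    congr 1; ring
  have hneg : (-1 : ℂ) = exp (Real.pi * I) := exp_pi_mul_I.symm
  have hterm : (-1) ^ k * q ^ (k.choose 2) * (x / q ^ m) ^ k =
      (-x) ^ m / q ^ ((m + 1).choose 2) *
        jacobiTheta₂_term ((k : ℤ) - m) (u + 1 / 2 - τ / 2) τ := by
    rw [eq_comm, div_mul_eq_mul_div, div_eq_iff (pow_ne_zero _ hq0), div_pow, mul_div_assoc',
      div_mul_eq_mul_div, eq_div_iff (pow_ne_zero _ (pow_ne_zero _ hq0)), neg_pow x, hneg,
      hchoose, hchoose, jacobiTheta₂_term, hqdef, hx]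
    simp only [← exp_nat_mul, ← exp_add]
    rw [exp_eq_exp_iff_exists_int]
    refine ⟨0, ?_⟩
    push_cast
    ring
  linear_combination qBinom q (m + m) k * hterm

lemma tendsto_qPoch {q : ℂ} (hq : ‖q‖ < 1) :
    ∃ L : ℂ, L ≠ 0 ∧ Tendsto (qPoch q) atTop (𝓝 L) := by
  have hs : Summable fun s : ℕ => ‖-(q ^ s * q)‖ := by
    simpa [norm_mul, norm_pow] using
      (summable_geometric_of_lt_one (norm_nonneg q) hq).mul_right ‖q‖
  refine ⟨∏' s : ℕ, (1 + -(q ^ s * q)), tprod_one_add_ne_zero_of_summable (fun s => ?_) hs, ?_⟩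
  · have := one_sub_pow_ne_zero hq s
    rwa [pow_succ, sub_eq_add_neg] at this
  · have h := (multipliable_one_add_of_summable hs).hasProd.tendsto_prod_nat
    refine h.congr fun m => ?_
    simp [qPoch, pow_succ, sub_eq_add_neg]

lemma exists_norm_qBinom_le {q : ℂ} (hq : ‖q‖ < 1) : ∃ C : ℝ, ∀ M k, ‖qBinom q M k‖ ≤ C := by
  obtain ⟨L, hL, hlim⟩ := tendsto_qPoch hq
  obtain ⟨B, hB⟩ := hlim.norm.bddAbove_range
  obtain ⟨B', hB'⟩ := (hlim.inv₀ hL).norm.bddAbove_range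
  have hB0 : ∀ m, ‖qPoch q m‖ ≤ B := fun m => hB ⟨m, rfl⟩
  have hB1 : ∀ m, ‖(qPoch q m)⁻¹‖ ≤ B' := fun m => hB' ⟨m, rfl⟩
  have p0 : 0 ≤ B := (norm_nonneg _).trans (hB0 0)
  have p1 : 0 ≤ B' := (norm_nonneg _).trans (hB1 0)
  refine ⟨B * (B' * B'), fun M k => ?_⟩
  unfold qBinom
  split_ifs
  · rw [div_eq_mul_inv, mul_inv, norm_mul, norm_mul]
    gcongr <;> simp only [hB0, hB1]
  · simp only [norm_zero]; positivity

open Complex in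
/-- The Jacobi triple product, with its constant left unspecified. -/
theorem exists_triple_product {τ : ℂ} (hτ : 0 < τ.im) :
    ∃ C : ℂ, ∀ u : ℂ, phiProd (exp (2 * Real.pi * I * τ)) (exp (2 * Real.pi * I * u)) *
      phiProd (exp (2 * Real.pi * I * τ))
        (exp (2 * Real.pi * I * τ) / exp (2 * Real.pi * I * u)) =
      C * jacobiTheta₂ (u + 1 / 2 - τ / 2) τ := by
  set q := exp (2 * Real.pi * I * τ) with hqdef
  have hq : ‖q‖ < 1 := norm_nome_lt_one hτ
  obtain ⟨L, hL, hlim⟩ := tendsto_qPoch hq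
  obtain ⟨B, hB⟩ := exists_norm_qBinom_le hq
  refine ⟨L⁻¹, fun u => ?_⟩
  set x := exp (2 * Real.pi * I * u) with hx
  have hlhs := (multipliable_phiProd hq x).hasProd.tendsto_prod_nat.mul
    (multipliable_phiProd hq (q / x)).hasProd.tendsto_prod_nat
  refine tendsto_nhds_unique hlhs ?_
  let f : ℕ → ℤ → ℂ := fun m j => (if 0 ≤ j + m then qBinom q (2 * m) (j + m).toNat else 0) *
    jacobiTheta₂_term j (u + 1 / 2 - τ / 2) τ
  have hf : ∀ m : ℕ, (∏ s ∈ range m, (1 - q ^ s * x)) * (∏ s ∈ range m, (1 - q ^ s * (q / x))) =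
      ∑' j, f m j := by
    intro m
    rw [finite_triple_product hτ u m]
    have hinj : Function.Injective fun k : ℕ => (k : ℤ) - m := fun a b h => by
      simpa using h
    rw [tsum_eq_sum (s := (range (2 * m + 1)).map ⟨_, hinj⟩), sum_map]
    · refine sum_congr rfl fun k _ => ?_
      simp [f]
      exact Or.inl rfl
    · intro j hj
      simp only [f]
      split_ifs with h0
      · have : ¬ (j + m).toNat ≤ 2 * m := by
          intro hle
          apply hj
          simp only [Finset.mem_map, mem_range, Function.Embedding.coeFn_mk]
          exact ⟨(j + m).toNat, by omega, by omega⟩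
        simp [qBinom, this]
      · simp
  simp_rw [hf]
  have hsum := (hasSum_jacobiTheta₂_term (u + 1 / 2 - τ / 2) hτ)
  rw [← (hsum.mul_left L⁻¹).tsum_eq]
  refine tendsto_tsum_of_dominated_convergence
    (bound := fun j => B * ‖jacobiTheta₂_term j (u + 1 / 2 - τ / 2) τ‖)
    (hsum.summable.norm.mul_left B) (fun j => ?_) (Eventually.of_forall fun m j => ?_)
  · refine Tendsto.mul_const _ ?_
    have t1 : Tendsto (fun m : ℕ => qPoch q (2 * m)) atTop (𝓝 L) :=
      hlim.comp (tendsto_id.const_mul_atTop' (by norm_num))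
    have t2 : Tendsto (fun m : ℕ => qPoch q (j + m).toNat) atTop (𝓝 L) := by
      refine hlim.comp (tendsto_atTop_atTop.2 fun b => ⟨b + j.natAbs, fun a ha => ?_⟩)
      omega
    have t3 : Tendsto (fun m : ℕ => qPoch q (2 * m - (j + m).toNat)) atTop (𝓝 L) := by
      refine hlim.comp (tendsto_atTop_atTop.2 fun b => ⟨b + j.natAbs, fun a ha => ?_⟩)
      omega
    have t := t1.div (t2.mul t3) (mul_ne_zero hL hL)
    have hLL : L / (L * L) = L⁻¹ := by field_simp
    rw [hLL] at t
    refine t.congr' ?_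
    filter_upwards [eventually_ge_atTop j.natAbs] with m hm
    rw [if_pos (by omega), qBinom, if_pos (by omega)]
    rfl
  · simp only [f, norm_mul]
    gcongr
    split_ifs
    · exact hB _ _
    · simpa using (norm_nonneg _).trans (hB 0 0)

/-! ### Properties of the theta function -/

lemma phiProd_eq_mul {q : ℂ} (hq : ‖q‖ < 1) (x : ℂ) :
    phiProd q x = (1 - x) * phiProd q (q * x) := by
  have e : ∀ s : ℕ, 1 - q ^ s * (q * x) = 1 - q ^ (s + 1) * x := fun s => by
    rw [pow_succ, mul_assoc]
  have h1 : Multipliable fun s : ℕ => 1 - q ^ (s + 1) * x :=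
    (multipliable_phiProd hq (q * x)).congr e
  have h2 := tprod_eq_zero_mul' (f := fun s : ℕ => 1 - q ^ s * x) h1
  simp only [phiProd, e]
  rw [h2, pow_zero, one_mul]

open Complex in
lemma exists_theta_eq {τ : ℂ} (hτ : 0 < τ.im) :
    ∃ C : ℂ, ∀ u : ℂ, theta τ u =
      C * exp (-(Real.pi * I * u)) * jacobiTheta₂ (u + 1 / 2 - τ / 2) τ := by
  obtain ⟨C, hC⟩ := exists_triple_product hτ
  refine ⟨-C, fun u => ?_⟩
  have hq := norm_nome_lt_one hτ
  have h := hC u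
  simp only [theta]
  set q := exp (2 * Real.pi * I * τ) with hqdef
  set x := exp (2 * Real.pi * I * u) with hx
  have hphi := phiProd_eq_mul hq x
  rw [hphi] at h
  have hxx : exp (Real.pi * I * u) = exp (-(Real.pi * I * u)) * x := by
    rw [hx, ← exp_add]; congr 1; ring
  rw [hxx]
  linear_combination (-exp (-(Real.pi * I * u))) * h

theorem theta_neg (τ u : ℂ) : theta τ (-u) = -theta τ u := by
  have h : Complex.exp (2 * Real.pi * Complex.I * -u) =
      (Complex.exp (2 * Real.pi * Complex.I * u))⁻¹ := by
    rw [← Complex.exp_neg, mul_neg]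
  simp only [theta, h]
  simp only [div_inv_eq_mul, ← div_eq_mul_inv, mul_neg, neg_neg]
  ring

lemma theta_sub_comm (τ u v : ℂ) : theta τ (u - v) = -theta τ (v - u) := by
  rw [← theta_neg, neg_sub]

theorem theta_zero (τ : ℂ) : theta τ 0 = 0 := by simp [theta]

theorem continuous_theta {τ : ℂ} (hτ : 0 < τ.im) : Continuous (theta τ) := by
  obtain ⟨C, hC⟩ := exists_theta_eq hτ
  have : theta τ = fun u => C * Complex.exp (-(Real.pi * Complex.I * u)) *
      jacobiTheta₂ (u + 1 / 2 - τ / 2) τ := funext hC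
  rw [this]
  have h : Continuous fun z => jacobiTheta₂ z τ :=
    continuous_iff_continuousAt.2 fun z => (differentiableAt_jacobiTheta₂_fst z hτ).continuousAt
  exact (by fun_prop : Continuous fun u : ℂ => C * Complex.exp (-(Real.pi * Complex.I * u))).mul
    (h.comp (by fun_prop))

lemma phiProd_ne_zero {q y : ℂ} (hq : ‖q‖ < 1) (h : ∀ s : ℕ, q ^ s * y ≠ 1) :
    phiProd q y ≠ 0 := by
  have hs : Summable fun s : ℕ => ‖-(q ^ s * y)‖ := by
    simpa [norm_mul, norm_pow] using
      (summable_geometric_of_lt_one (norm_nonneg q) hq).mul_right ‖y‖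
  have := tprod_one_add_ne_zero_of_summable
    (fun s => by rw [← sub_eq_add_neg]; exact sub_ne_zero.2 (h s).symm) hs
  simpa [phiProd, sub_eq_add_neg] using this

open Complex in
/-- All zeros of `theta τ` lie in the lattice `ℤ + ℤ τ`. -/
theorem exists_eq_of_theta_eq_zero {τ : ℂ} (hτ : 0 < τ.im) {u : ℂ} (h : theta τ u = 0) :
    ∃ r k : ℤ, u = r * τ + k := by
  have hq := norm_nome_lt_one hτ
  have hpi : (2 * Real.pi * I : ℂ) ≠ 0 := by simp [Real.pi_ne_zero]
  -- Each vanishing factor says that `exp (2πi u)` is an integral power of `q`.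
  suffices ∃ r : ℤ, exp (2 * Real.pi * I * u) = exp (r * (2 * Real.pi * I * τ)) by
    obtain ⟨r, hr⟩ := this
    obtain ⟨k, hk⟩ := exp_eq_exp_iff_exists_int.1 hr
    refine ⟨r, k, mul_left_cancel₀ hpi ?_⟩
    rw [hk]; ring
  by_contra hne
  push Not at hne
  refine absurd h ?_
  have hx0 := exp_ne_zero (2 * Real.pi * I * u)
  refine mul_ne_zero (mul_ne_zero ?_ (phiProd_ne_zero hq fun s hs => ?_))
    (phiProd_ne_zero hq fun s hs => ?_)
  · intro h0
    apply hne 0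
    rw [sub_eq_zero] at h0
    have : exp (2 * Real.pi * I * u) = exp (Real.pi * I * u) * exp (Real.pi * I * u) := by
      rw [← exp_add]; congr 1; ring
    rw [this]
    nth_rewrite 2 [h0]
    rw [← exp_add]; congr 1; push_cast; ring
  · apply hne (-(s + 1 : ℕ))
    rw [← mul_assoc, ← pow_succ] at hs
    rw [← exp_nat_mul] at hs
    rw [eq_inv_of_mul_eq_one_right hs, ← exp_neg]
    congr 1; push_cast; ring
  · apply hne (s + 1 : ℕ)
    rw [mul_div_assoc', div_eq_one_iff_eq hx0, ← pow_succ, ← exp_nat_mul] at hs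
    rw [← hs]
    push_cast; rfl

lemma countable_theta_zeros {τ : ℂ} (hτ : 0 < τ.im) : {u | theta τ u = 0}.Countable := by
  refine (Set.countable_range fun p : ℤ × ℤ => (p.1 * τ + p.2 : ℂ)).mono fun u hu => ?_
  obtain ⟨r, k, rfl⟩ := exists_eq_of_theta_eq_zero hτ hu
  exact ⟨(r, k), rfl⟩

lemma hasSum_jacobiTheta₂_term_mul {τ : ℂ} (hτ : 0 < τ.im) (a b : ℂ) :
    HasSum (fun p : ℤ × ℤ => jacobiTheta₂_term p.1 a τ * jacobiTheta₂_term p.2 b τ)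
      (jacobiTheta₂ a τ * jacobiTheta₂ b τ) := by
  have ha := hasSum_jacobiTheta₂_term a hτ
  have hb := hasSum_jacobiTheta₂_term b hτ
  exact HasSum.mul (f := fun m => jacobiTheta₂_term m a τ) (g := fun n => jacobiTheta₂_term n b τ)
    ha hb (summable_mul_of_summable_norm (f := fun m => jacobiTheta₂_term m a τ)
      (g := fun n => jacobiTheta₂_term n b τ) ha.summable.norm hb.summable.norm)

/-- Pairs of integers with even sum, respectively odd sum, in terms of half their sum and
difference. -/
def parityMap : (ℤ × ℤ) ⊕ (ℤ × ℤ) → ℤ × ℤ :=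
  Sum.elim (fun p => (p.1 + p.2, p.1 - p.2)) (fun p => (p.1 + p.2 + 1, p.1 - p.2))

lemma parityMap_bijective : Function.Bijective parityMap := by
  constructor
  · rintro (⟨a, b⟩ | ⟨a, b⟩) (⟨c, d⟩ | ⟨c, d⟩) h <;>
      simp only [parityMap, Sum.elim_inl, Sum.elim_inr, Prod.mk.injEq] at h
    · rw [show a = c by omega, show b = d by omega]
    · omega
    · omega
    · rw [show a = c by omega, show b = d by omega]
  · rintro ⟨m, n⟩
    rcases Int.even_or_odd (m + n) with ⟨k, hk⟩ | ⟨k, hk⟩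
    · refine ⟨Sum.inl (k, m - k), ?_⟩
      simp only [parityMap, Sum.elim_inl, Prod.mk.injEq]
      omega
    · refine ⟨Sum.inr (k, m - k - 1), ?_⟩
      simp only [parityMap, Sum.elim_inr, Prod.mk.injEq]
      omega

open Complex in
/-- The addition formula for a product of two Jacobi theta series: split the double series
according to the parity of `m + n`. -/
lemma jacobiTheta₂_mul {τ : ℂ} (hτ : 0 < τ.im) (a b : ℂ) :
    jacobiTheta₂ a τ * jacobiTheta₂ b τ =
      jacobiTheta₂ (a + b) (2 * τ) * jacobiTheta₂ (a - b) (2 * τ) +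
      exp (2 * Real.pi * I * a + Real.pi * I * τ) *
        (jacobiTheta₂ (a + b + τ) (2 * τ) * jacobiTheta₂ (a - b + τ) (2 * τ)) := by
  have h2τ : 0 < (2 * τ).im := by simpa using hτ
  have h0 := (Equiv.ofBijective _ parityMap_bijective).hasSum_iff.2
    (hasSum_jacobiTheta₂_term_mul hτ a b)
  have h1 := hasSum_jacobiTheta₂_term_mul h2τ (a + b) (a - b)
  have h2 := (hasSum_jacobiTheta₂_term_mul h2τ (a + b + τ) (a - b + τ)).mul_left
    (exp (2 * Real.pi * I * a + Real.pi * I * τ))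
  refine h0.unique (HasSum.sum (h1.congr_fun fun p => ?_) (h2.congr_fun fun p => ?_))
  · simp only [Function.comp_apply, Equiv.ofBijective_apply, parityMap, Sum.elim_inl,
      jacobiTheta₂_term, ← exp_add]
    congr 1
    push_cast
    ring
  · simp only [Function.comp_apply, Equiv.ofBijective_apply, parityMap, Sum.elim_inr,
      jacobiTheta₂_term, ← exp_add]
    congr 1
    push_cast
    ring

open Complex in
/-- `θ(u + v) θ(u - v)` is an alternating form of rank two in `u` and `v`. -/
theorem exists_theta_mul_theta {τ : ℂ} (hτ : 0 < τ.im) :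
    ∃ A B : ℂ → ℂ, ∀ u v, theta τ (u + v) * theta τ (u - v) = B u * A v - A u * B v := by
  obtain ⟨C, hC⟩ := exists_theta_eq hτ
  refine ⟨fun u => C * jacobiTheta₂ (2 * u) (2 * τ),
    fun u => C * (exp (2 * Real.pi * I * u) * jacobiTheta₂ (2 * u + τ) (2 * τ)), fun u v => ?_⟩
  have e1 : u + v + 1 / 2 - τ / 2 + (u - v + 1 / 2 - τ / 2) = 2 * u - τ + 1 := by ring
  have e2 : u + v + 1 / 2 - τ / 2 - (u - v + 1 / 2 - τ / 2) = 2 * v := by ring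
  have e3 : 2 * u - τ + 1 + τ = 2 * u + 1 := by ring
  have e4 : 2 * u + τ = 2 * u - τ + 2 * τ := by ring
  beta_reduce
  rw [hC, hC, mul_mul_mul_comm, jacobiTheta₂_mul hτ, e1, e2, e3, e4, jacobiTheta₂_add_left,
    jacobiTheta₂_add_left, jacobiTheta₂_add_left' (2 * u - τ)]
  have x1 : exp (-(Real.pi * I * (u + v))) * exp (-(Real.pi * I * (u - v))) =
      exp (2 * Real.pi * I * u) * exp (-Real.pi * I * (2 * τ + 2 * (2 * u - τ))) := by
    rw [← exp_add, ← exp_add]; congr 1; ring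
  have x2 : exp (-(Real.pi * I * (u + v))) * exp (-(Real.pi * I * (u - v))) *
      exp (2 * Real.pi * I * (u + v + 1 / 2 - τ / 2) + Real.pi * I * τ) =
      -exp (2 * Real.pi * I * v) := by
    have : -exp (2 * Real.pi * I * v) = exp (Real.pi * I) * exp (2 * Real.pi * I * v) := by
      rw [exp_pi_mul_I]; ring
    rw [this, ← exp_add, ← exp_add, ← exp_add]; congr 1; ring
  linear_combination C * C * jacobiTheta₂ (2 * u - τ) (2 * τ) * jacobiTheta₂ (2 * v) (2 * τ) * x1 +
    C * C * jacobiTheta₂ (2 * u) (2 * τ) * jacobiTheta₂ (2 * v + τ) (2 * τ) * x2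

/-- The three-term (Weierstrass) identity, a Plücker relation for the form of
`exists_theta_mul_theta`. -/
theorem theta_three_term {τ : ℂ} (hτ : 0 < τ.im) (x y z w : ℂ) :
    theta τ (x + y) * theta τ (x - y) * (theta τ (z + w) * theta τ (z - w)) +
      theta τ (x + z) * theta τ (x - z) * (theta τ (w + y) * theta τ (w - y)) +
      theta τ (x + w) * theta τ (x - w) * (theta τ (y + z) * theta τ (y - z)) = 0 := by
  obtain ⟨A, B, h⟩ := exists_theta_mul_theta hτ
  simp only [h]
  ring

/-- The three-term identity with the arguments that occur when the dynamical parameters of two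
neighbouring variables are exchanged. -/
lemma theta_three_term_dyn {τ : ℂ} (hτ : 0 < τ.im) (u v p A B : ℂ) :
    theta τ u * theta τ (v + (A - B)) * theta τ (p + B) * theta τ (p + u - v + A) -
      theta τ v * theta τ (u + (A - B)) * theta τ (p + A) * theta τ (p + u - v + B) =
    theta τ (A - B) * theta τ (u - v) * theta τ (p + u + A) * theta τ (p - v + B) := by
  have h := theta_three_term hτ ((u + v + A - B) / 2) ((u - v - A + B) / 2)
    ((u - v) / 2 + p + (A + B) / 2) ((v - u - A + B) / 2)
  ring_nf at h
  have e1 : theta τ (v - B - p) = -theta τ (p - v + B) := by rw [← theta_neg]; ring_nf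
  have e2 : theta τ (-u + v) = -theta τ (u - v) := by rw [← theta_neg]; ring_nf
  have e3 : theta τ (-A + B) = -theta τ (A - B) := by rw [← theta_neg]; ring_nf
  have e4 : theta τ (-A - p) = -theta τ (p + A) := by rw [← theta_neg]; ring_nf
  rw [e1, e2, e3, e4] at h
  ring_nf at h ⊢
  linear_combination h

/-- The three-term identity with the arguments that occur when two neighbouring variables are
exchanged. -/
lemma theta_three_term_shift {τ : ℂ} (hτ : 0 < τ.im) (u v p η : ℂ) :
    theta τ η * theta τ (p + u) * theta τ (η + p - v) * theta τ (u - v) +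
      theta τ u * theta τ (v - η) * theta τ (p + u - v) * theta τ (η + p) =
    theta τ v * theta τ (u - η) * theta τ p * theta τ (η + p + u - v) := by
  have h := theta_three_term hτ ((u + p + η) / 2) ((η - u - p) / 2)
    ((u + p + η) / 2 - v) ((p + η - u) / 2)
  ring_nf at h
  have e1 : theta τ (-u + η) = -theta τ (u - η) := by rw [← theta_neg]; ring_nf
  have e2 : theta τ (η - v) = -theta τ (v - η) := by rw [← theta_neg]; ring_nf
  have e3 : theta τ (-u - p + v) = -theta τ (p + u - v) := by rw [← theta_neg]; ring_nf
  rw [e1, e2, e3] at h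
  ring_nf at h ⊢
  linear_combination h

/-! ### The exchange coefficients -/

/-- The diagonal coefficient of the exchange relation: that of the weight function with the variables
of the two neighbours in place. Here `u` is the difference of these variables and `D` that of the
dynamical variables of the two colors. -/
def alphaCoeff (τ η D u : ℂ) : ℂ := theta τ η * theta τ (u + D) / (theta τ D * theta τ u)

/-- The off-diagonal coefficient of the exchange relation: that of the weight function with the
variables of the two neighbours exchanged. -/
def betaCoeff (τ η u : ℂ) : ℂ := theta τ (u - η) / theta τ u

lemma alphaCoeff_neg (τ η D u : ℂ) : alphaCoeff τ η (-D) (-u) = -alphaCoeff τ η D u := by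
  have : -u + -D = -(u + D) := by ring
  simp only [alphaCoeff, this, theta_neg]
  ring

lemma alphaCoeff_neg_eta {τ η : ℂ} (hη : theta τ η ≠ 0) (u : ℂ) :
    alphaCoeff τ η (-η) u = -betaCoeff τ η u := by
  simp only [alphaCoeff, betaCoeff, theta_neg, ← sub_eq_add_neg]
  rw [neg_mul, div_neg, mul_div_mul_left _ _ hη]

/-- The factors of `U_I` that involve only the two variables `t₁, t₂` at neighbouring positions of
one level and the two variables `x, y` at the same positions of the next level. -/
def pairFactor (τ η A B t₁ t₂ x y : ℂ) : ℂ :=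
  theta τ (x - t₁ + A) / theta τ A * theta τ (y - t₁) * theta τ (η + (x - t₂)) *
    (theta τ (y - t₂ + B) / theta τ B) * (theta τ (η + (t₂ - t₁)) / theta τ (t₂ - t₁))

/-- The exchange relation for `pairFactor`: exchanging the dynamical parameters `A` and `B` after
the coefficients have acted on `t₁, t₂` amounts to letting the coefficients act on `x, y`. -/
lemma pairFactor_exchange {τ : ℂ} (hτ : 0 < τ.im) {η A B t₁ t₂ x y : ℂ}
    (hA : theta τ A ≠ 0) (hB : theta τ B ≠ 0) (hD : theta τ (A - B) ≠ 0)
    (hu : theta τ (y - x) ≠ 0) (hv : theta τ (t₂ - t₁) ≠ 0) :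
    alphaCoeff τ η (A - B) (t₂ - t₁) * pairFactor τ η B A t₁ t₂ x y +
        betaCoeff τ η (t₁ - t₂) * pairFactor τ η B A t₂ t₁ x y =
      alphaCoeff τ η (A - B) (y - x) * pairFactor τ η A B t₁ t₂ x y +
        betaCoeff τ η (y - x) * pairFactor τ η A B t₁ t₂ y x := by
  obtain ⟨p, rfl⟩ : ∃ p, x = p + t₁ := ⟨x - t₁, by ring⟩
  obtain ⟨u, rfl⟩ : ∃ u, y = u + (p + t₁) := ⟨y - (p + t₁), by ring⟩
  obtain ⟨v, rfl⟩ : ∃ v, t₂ = v + t₁ := ⟨t₂ - t₁, by ring⟩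
  have h1 := theta_three_term_dyn hτ u v p A B
  have h2 := theta_three_term_shift hτ u v p η
  have n1 : theta τ (t₁ - (v + t₁)) = -theta τ v := by rw [← theta_neg]; ring_nf
  have n2 : theta τ (t₁ - (v + t₁) - η) = -theta τ (η + v) := by rw [← theta_neg]; ring_nf
  have n3 : theta τ (η + (t₁ - (v + t₁))) = -theta τ (v - η) := by rw [← theta_neg]; ring_nf
  simp only [alphaCoeff, betaCoeff, pairFactor, n1, n2, n3]
  simp only [add_sub_cancel_right] at hu hv ⊢
  have e1 : u + (p + t₁) - t₁ = p + u := by ring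
  have e2 : p + t₁ - (v + t₁) = p - v := by ring
  have e3 : u + (p + t₁) - (v + t₁) = p + u - v := by ring
  have e4 : η + (p - v) = η + p - v := by ring
  have e5 : η + (p + u - v) = η + p + u - v := by ring
  rw [e1, e2, e3, e4, e5]
  field_simp
  linear_combination theta τ (η + v) * theta τ η * theta τ (p + u) * theta τ (η + p - v) * h1 +
    theta τ (η + v) * theta τ (A - B) * theta τ (p + u + A) * theta τ (p - v + B) * h2

lemma pairFactor_symm {τ : ℂ} (hτ : 0 < τ.im) {η A t₁ t₂ x y : ℂ} (hη : theta τ η ≠ 0)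
    (hA : theta τ A ≠ 0) (hB : theta τ (A + η) ≠ 0)
    (hu : theta τ (y - x) ≠ 0) (hu' : theta τ (y - x - η) ≠ 0) (hv : theta τ (t₂ - t₁) ≠ 0) :
    pairFactor τ η A (A + η) t₁ t₂ x y + pairFactor τ η A (A + η) t₂ t₁ x y =
      pairFactor τ η A (A + η) t₁ t₂ y x + pairFactor τ η A (A + η) t₂ t₁ y x := by
  have hD : A - (A + η) = -η := by ring
  have hv' : theta τ (t₁ - t₂) ≠ 0 := by rw [theta_sub_comm]; exact neg_ne_zero.2 hv
  have hηn : theta τ (A - (A + η)) ≠ 0 := by rw [hD, theta_neg]; exact neg_ne_zero.2 hη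
  -- For `D = -η` the two coefficients are opposite, so the left hand side of the exchange
  -- relation is alternating in `t₁, t₂`.
  have h1 := pairFactor_exchange hτ (η := η) hA hB hηn hu hv
  have h2 := pairFactor_exchange hτ (η := η) hA hB hηn hu hv'
  rw [hD] at h1 h2
  simp only [alphaCoeff_neg_eta hη] at h1 h2
  have hb : betaCoeff τ η (y - x) ≠ 0 := div_ne_zero hu' hu
  apply mul_left_cancel₀ hb
  linear_combination h1 + h2

/-- The exchange relation at the first level where both variables occur. -/
lemma single_exchange {τ : ℂ} (hτ : 0 < τ.im) {η D t x y : ℂ} (hD : theta τ D ≠ 0)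
    (hηD : theta τ (η + D) ≠ 0) (hu : theta τ (y - x) ≠ 0) :
    theta τ (η + (x - t)) * (theta τ (y - t + D) / theta τ D) =
      alphaCoeff τ η D (y - x) * (theta τ (x - t + (η + D)) / theta τ (η + D) * theta τ (y - t)) +
      betaCoeff τ η (y - x) *
        (theta τ (y - t + (η + D)) / theta τ (η + D) * theta τ (x - t)) := by
  obtain ⟨p, rfl⟩ : ∃ p, x = p + t := ⟨x - t, by ring⟩
  obtain ⟨u, rfl⟩ : ∃ u, y = u + (p + t) := ⟨y - (p + t), by ring⟩
  have e1 : u + (p + t) - t = p + u := by ring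
  simp only [alphaCoeff, betaCoeff, e1]
  simp only [add_sub_cancel_right] at hu ⊢
  have h := theta_three_term_shift hτ u (-D) p η
  have e2 : -D - η = -(η + D) := by ring
  have e3 : p + (η + D) = η + p + D := by ring
  have e4 : p + u + (η + D) = η + p + u + D := by ring
  rw [e2, theta_neg, theta_neg, sub_neg_eq_add, sub_neg_eq_add, sub_neg_eq_add, sub_neg_eq_add] at h
  rw [e3, e4]
  field_simp
  linear_combination -h

/-! ### Weight functions of a coloring -/

section Coloring

variable {n : ℕ}

/-- The number of elements of color `l` before `i`. -/
def colorCount (c : Fin n → ℕ) (l : ℕ) (i : Fin n) : ℕ := #{b | c b = l ∧ b < i}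

/-- The dynamical argument of the element `i` at level `m`; the block following the first `m`
blocks has color `m`. -/
def dyn (η : ℂ) (ν : ℕ → ℂ) (c : Fin n → ℕ) (m : ℕ) (i : Fin n) : ℂ :=
  (1 + (colorCount c (c i) i : ℂ) - (colorCount c m i : ℂ)) * η + ν m - ν (c i)

/-- The factor of the pair `(i, k)`, with `i` at level `m` and `k` at level `m + 1`. -/
def pairPsi (τ η : ℂ) (ν : ℕ → ℂ) (c : Fin n → ℕ) (m : ℕ) (i k : Fin n) (u : ℂ) : ℂ :=
  if k < i then theta τ (η + u)
  else if k = i then theta τ (u + dyn η ν c m i) / theta τ (dyn η ν c m i)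
  else theta τ u

/-- `pairPsi` extended by `1` to all pairs. -/
def interFactor (τ η : ℂ) (ν : ℕ → ℂ) (c : Fin n → ℕ) (m : ℕ) (T T' : Fin n → ℂ)
    (i k : Fin n) : ℂ :=
  if c i < m ∧ c k < m + 1 then pairPsi τ η ν c m i k (T' k - T i) else 1

/-- The factor of a pair `(i, b)` within level `m`, extended by `1` to all pairs. -/
def intraFactor (τ η : ℂ) (c : Fin n → ℕ) (m : ℕ) (T : Fin n → ℂ) (i b : Fin n) : ℂ :=
  if (c i < m ∧ c b < m) ∧ i < b then theta τ (η + (T b - T i)) / theta τ (T b - T i) else 1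

/-- The part of `U_I` belonging to level `m`. A coloring `c` stands for the partition into its
color classes, and the elements `i` with `c i < m` carry the variables `T i` of level `m`; the
variables `T'` are those of level `m + 1`. -/
def levelFactor (τ η : ℂ) (ν : ℕ → ℂ) (c : Fin n → ℕ) (m : ℕ) (T T' : Fin n → ℂ) : ℂ :=
  (∏ i, ∏ k, interFactor τ η ν c m T T' i k) * ∏ i, ∏ b, intraFactor τ η c m T i b

variable {X : ℕ → Type*} [∀ m, Fintype (X m)] [∀ m, DecidableEq (X m)]

/-- An assignment of the variables `t` of level `m` to the elements `i` with `c i < m`, extended by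
zero. -/
def assign {c : Fin n → ℕ} {m : ℕ} {Y : Type*} (t : Y → ℂ) (e : {i // c i < m} ≃ Y) : Fin n → ℂ :=
  fun i => if h : c i < m then t (e ⟨i, h⟩) else 0

/-- The sum over all assignments of the variables `t` to the elements `i` with `c i < m`. -/
def levelSum {Y : Type*} [Fintype Y] [DecidableEq Y] (t : Y → ℂ) (c : Fin n → ℕ) (m : ℕ)
    (F : (Fin n → ℂ) → ℂ) : ℂ :=
  ∑ e : {i // c i < m} ≃ Y, F (assign t e)

/-- The symmetrization of the product of the factors of all levels below `m`, as a function of the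
variables `T` of level `m`, with values `t` substituted for the variables of the lower levels. -/
def weight (τ η : ℂ) (ν : ℕ → ℂ) (t : ∀ m, X m → ℂ) (c : Fin n → ℕ) : ℕ → (Fin n → ℂ) → ℂ
  | 0, _ => 1
  | m + 1, T' => levelSum (t m) c m fun T =>
      levelFactor τ η ν c m T T' * weight τ η ν t c m T

lemma levelSum_reindex {Y : Type*} [Fintype Y] [DecidableEq Y] (t : Y → ℂ) {c c' : Fin n → ℕ}
    {m : ℕ} (s : Equiv.Perm (Fin n)) (h : ∀ i, c' i < m ↔ c (s i) < m) (F : (Fin n → ℂ) → ℂ) :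
    levelSum t c' m F = levelSum t c m fun T => F (T ∘ s) := by
  unfold levelSum
  let σ : {i // c' i < m} ≃ {i // c i < m} := s.subtypeEquiv h
  refine (Equiv.sum_comp (σ.symm.equivCongr (Equiv.refl Y)) _).symm.trans ?_
  refine sum_congr rfl fun e _ => congrArg F ?_
  funext i
  simp only [assign, Function.comp_apply, h]
  rfl

lemma levelSum_congr {Y : Type*} [Fintype Y] [DecidableEq Y] {t : Y → ℂ} {c : Fin n → ℕ} {m : ℕ}
    {F G : (Fin n → ℂ) → ℂ} (h : ∀ e : {i // c i < m} ≃ Y, F (assign t e) = G (assign t e)) :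
    levelSum t c m F = levelSum t c m G :=
  sum_congr rfl fun e _ => h e

lemma assign_ne {Y : Type*} {t : Y → ℂ} {P : ℂ → ℂ → Prop} (ht : ∀ a b, a ≠ b → P (t a) (t b))
    {c : Fin n → ℕ} {m : ℕ} (e : {i // c i < m} ≃ Y) {i k : Fin n} (hi : c i < m) (hk : c k < m)
    (hik : i ≠ k) : P (assign t e i) (assign t e k) := by
  simp only [assign, hi, hk, dif_pos]
  exact ht _ _ fun h => hik (congrArg Subtype.val (e.injective h))

/-! ### Products over pairs -/

/-- The product of `F` over the pairs not contained in `{a, a'}`. -/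
def outerProd (a a' : Fin n) (F : Fin n → Fin n → ℂ) : ℂ :=
  ∏ i, ∏ k, if (i = a ∨ i = a') ∧ (k = a ∨ k = a') then 1 else F i k

lemma prod_eq_outerProd_mul {a a' : Fin n} (h : a ≠ a') (F : Fin n → Fin n → ℂ) :
    ∏ i, ∏ k, F i k = outerProd a a' F * (F a a * F a a' * (F a' a * F a' a')) := by
  have hsplit : ∏ i, ∏ k, F i k = outerProd a a' F *
      ∏ i, ∏ k, if (i = a ∨ i = a') ∧ (k = a ∨ k = a') then F i k else 1 := by
    rw [outerProd, ← prod_mul_distrib]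
    refine prod_congr rfl fun i _ => ?_
    rw [← prod_mul_distrib]
    refine prod_congr rfl fun k _ => ?_
    split_ifs <;> simp
  have hinner : ∀ i, (i = a ∨ i = a') →
      (∏ k, if (i = a ∨ i = a') ∧ (k = a ∨ k = a') then F i k else 1) = F i a * F i a' := by
    intro i hi
    rw [prod_eq_mul a a' h]
    · simp [hi]
    · rintro k - ⟨h1, h2⟩
      simp [h1, h2]
    · simp
    · simp
  rw [hsplit, prod_eq_mul a a' h]
  · rw [hinner a (Or.inl rfl), hinner a' (Or.inr rfl)]
  · rintro i - ⟨h1, h2⟩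
    simp [h1, h2]
  · simp
  · simp

lemma outerProd_congr {a a' : Fin n} {F F' : Fin n → Fin n → ℂ} (σ₁ σ₂ : Equiv.Perm (Fin n))
    (h₁ : ∀ i, σ₁ i = a ∨ σ₁ i = a' ↔ i = a ∨ i = a')
    (h₂ : ∀ i, σ₂ i = a ∨ σ₂ i = a' ↔ i = a ∨ i = a')
    (h : ∀ i k, ¬((i = a ∨ i = a') ∧ (k = a ∨ k = a')) → F' i k = F (σ₁ i) (σ₂ k)) :
    outerProd a a' F' = outerProd a a' F := by
  unfold outerProd
  conv_rhs => rw [← Equiv.prod_comp σ₁]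
  refine prod_congr rfl fun i _ => ?_
  conv_rhs => rw [← Equiv.prod_comp σ₂]
  refine prod_congr rfl fun k _ => ?_
  simp only [h₁, h₂]
  split_ifs with hc
  · rfl
  · exact h i k hc

end Coloring

/-! ### Exchanging two neighbouring elements -/

section Exchange

variable {n : ℕ} {a a' : Fin n}

lemma swap_mem_pair (i : Fin n) :
    Equiv.swap a a' i = a ∨ Equiv.swap a a' i = a' ↔ i = a ∨ i = a' := by
  by_cases h1 : i = a
  · simp [h1]
  by_cases h2 : i = a'
  · simp [h2]
  rw [Equiv.swap_apply_of_ne_of_ne h1 h2]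

lemma color_swap_lt_iff {c : Fin n → ℕ} {m : ℕ} (ha : c a < m) (ha' : c a' < m) (k : Fin n) :
    c (Equiv.swap a a' k) < m ↔ c k < m := by
  by_cases h1 : k = a
  · subst h1; rw [Equiv.swap_apply_left]; tauto
  by_cases h2 : k = a'
  · subst h2; rw [Equiv.swap_apply_right]; tauto
  rw [Equiv.swap_apply_of_ne_of_ne h1 h2]

lemma swap_lt_iff (h : a < a') (hadj : ∀ k, a < k → ¬k < a') {i k : Fin n}
    (hik : ¬((i = a ∨ i = a') ∧ (k = a ∨ k = a'))) : Equiv.swap a a' i < k ↔ i < k := by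
  have := hadj k
  by_cases h1 : i = a
  · subst h1
    rw [Equiv.swap_apply_left]
    grind
  by_cases h2 : i = a'
  · subst h2
    rw [Equiv.swap_apply_right]
    grind
  rw [Equiv.swap_apply_of_ne_of_ne h1 h2]

lemma lt_swap_iff (h : a < a') (hadj : ∀ k, a < k → ¬k < a') {i k : Fin n}
    (hik : ¬((i = a ∨ i = a') ∧ (k = a ∨ k = a'))) : k < Equiv.swap a a' i ↔ k < i := by
  have := hadj k
  by_cases h1 : i = a
  · subst h1
    rw [Equiv.swap_apply_left]
    grind
  by_cases h2 : i = a'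
  · subst h2
    rw [Equiv.swap_apply_right]
    grind
  rw [Equiv.swap_apply_of_ne_of_ne h1 h2]

lemma swap_eq_iff {i k : Fin n}
    (hik : ¬((i = a ∨ i = a') ∧ (k = a ∨ k = a'))) : k = Equiv.swap a a' i ↔ k = i := by
  by_cases h1 : i = a
  · subst h1
    rw [Equiv.swap_apply_left]
    grind
  by_cases h2 : i = a'
  · subst h2
    rw [Equiv.swap_apply_right]
    grind
  rw [Equiv.swap_apply_of_ne_of_ne h1 h2]

lemma colorCount_comp_swap (h : a < a') (hadj : ∀ k, a < k → ¬k < a') (c : Fin n → ℕ) (l : ℕ)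
    {i : Fin n} (hi : i ≠ a') : colorCount (c ∘ Equiv.swap a a') l i = colorCount c l i := by
  refine card_equiv (Equiv.swap a a') fun b => ?_
  simp only [mem_filter, mem_univ, true_and, Function.comp_apply, and_congr_right_iff]
  intro _
  by_cases hia : i = a
  · subst hia
    by_cases h1 : b = i
    · subst h1
      rw [Equiv.swap_apply_left]
      grind
    by_cases h2 : b = a'
    · subst h2
      rw [Equiv.swap_apply_right]
      grind
    rw [Equiv.swap_apply_of_ne_of_ne h1 h2]
  · rw [swap_lt_iff h hadj (by tauto)]

lemma colorCount_snd (h : a < a') (hadj : ∀ k, a < k → ¬k < a') (c : Fin n → ℕ) (l : ℕ) :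
    colorCount c l a' = colorCount c l a + if c a = l then 1 else 0 := by
  have hlt : ∀ b, b < a' ↔ b < a ∨ b = a := fun b => by
    have := hadj b; grind
  unfold colorCount
  simp only [hlt, and_or_left]
  rw [filter_or, card_union_of_disjoint]
  · congr 1
    split_ifs with hc
    · rw [card_eq_one]
      exact ⟨a, by ext b; simp; grind⟩
    · rw [card_eq_zero]
      ext b; simp; grind
  · rw [disjoint_filter]
    rintro b - ⟨-, h1⟩ ⟨-, h2⟩
    exact absurd h2 h1.ne

/-- The dynamical variable of color `l` at the element `a`. -/
def dynVar (η : ℂ) (ν : ℕ → ℂ) (c : Fin n → ℕ) (a : Fin n) (l : ℕ) : ℂ :=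
  (colorCount c l a : ℂ) * η - ν l

lemma dyn_eq (η : ℂ) (ν : ℕ → ℂ) (c : Fin n → ℕ) (m : ℕ) (a : Fin n) :
    dyn η ν c m a = η + dynVar η ν c a (c a) - dynVar η ν c a m := by
  simp only [dyn, dynVar]; ring

lemma dyn_snd (h : a < a') (hadj : ∀ k, a < k → ¬k < a') (η : ℂ) (ν : ℕ → ℂ) (c : Fin n → ℕ)
    (m : ℕ) : dyn η ν c m a' = η + dynVar η ν c a (c a') - dynVar η ν c a m +
      ((if c a = c a' then 1 else 0) - (if c a = m then 1 else 0)) * η := by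
  simp only [dyn, dynVar, colorCount_snd h hadj]
  push_cast
  ring

lemma dynVar_comp_swap (h : a < a') (hadj : ∀ k, a < k → ¬k < a') (η : ℂ) (ν : ℕ → ℂ)
    (c : Fin n → ℕ) (l : ℕ) :
    dynVar η ν (c ∘ Equiv.swap a a') a l = dynVar η ν c a l := by
  simp only [dynVar, colorCount_comp_swap h hadj c l h.ne]

lemma dyn_comp_swap (h : a < a') (hadj : ∀ k, a < k → ¬k < a') (η : ℂ) (ν : ℕ → ℂ)
    (c : Fin n → ℕ) (m : ℕ) {i : Fin n} (hi : ¬(i = a ∨ i = a')) :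
    dyn η ν (c ∘ Equiv.swap a a') m i = dyn η ν c m i := by
  push Not at hi
  simp only [dyn, colorCount_comp_swap h hadj c _ hi.2, Function.comp_apply,
    Equiv.swap_apply_of_ne_of_ne hi.1 hi.2]

lemma pairPsi_congr {τ η : ℂ} {ν : ℕ → ℂ} {c c' : Fin n → ℕ} {m : ℕ} {i k i₂ k₂ : Fin n}
    (h₁ : k < i ↔ k₂ < i₂) (h₂ : k = i ↔ k₂ = i₂)
    (h₃ : k = i → dyn η ν c' m i = dyn η ν c m i₂) (u : ℂ) :
    pairPsi τ η ν c' m i k u = pairPsi τ η ν c m i₂ k₂ u := by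
  unfold pairPsi
  split_ifs <;> grind

/-- The factors of `levelFactor` other than those of the pairs in `{a, a'}`. -/
def outerFactor (a a' : Fin n) (τ η : ℂ) (ν : ℕ → ℂ) (c : Fin n → ℕ) (m : ℕ) (T T' : Fin n → ℂ) :
    ℂ :=
  outerProd a a' (interFactor τ η ν c m T T') * outerProd a a' (intraFactor τ η c m T)

/-- Off the pair `{a, a'}` only the relative order of the elements matters, so that simultaneously
exchanging the colors and the variables has no effect. -/
lemma outerFactor_comp_swap (h : a < a') (hadj : ∀ k, a < k → ¬k < a') (τ η : ℂ) (ν : ℕ → ℂ)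
    {c : Fin n → ℕ} {m : ℕ} (ha : c a < m + 1) (ha' : c a' < m + 1) (T T' : Fin n → ℂ) :
    outerFactor a a' τ η ν (c ∘ Equiv.swap a a') m (T ∘ Equiv.swap a a') T' =
      outerFactor a a' τ η ν c m T T' := by
  have hs := color_swap_lt_iff ha ha'
  unfold outerFactor
  congr 1
  · refine outerProd_congr (Equiv.swap a a') (Equiv.refl _) swap_mem_pair (fun _ => Iff.rfl) ?_
    intro i k hik
    simp only [interFactor, Function.comp_apply, Equiv.refl_apply, hs]
    by_cases hc : c (Equiv.swap a a' i) < m ∧ c k < m + 1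
    · rw [if_pos hc]
      refine Eq.trans ?_ (if_pos hc).symm
      refine pairPsi_congr (lt_swap_iff h hadj hik).symm (swap_eq_iff hik).symm ?_ _
      rintro rfl
      have hk : ¬(k = a ∨ k = a') := by tauto
      rw [dyn_comp_swap h hadj _ _ _ _ hk, Equiv.swap_apply_of_ne_of_ne] <;> tauto
    · rw [if_neg hc]
      exact (if_neg hc).symm
  · refine outerProd_congr (Equiv.swap a a') (Equiv.swap a a') swap_mem_pair swap_mem_pair ?_
    intro i k hik
    have hik' : ¬((Equiv.swap a a' i = a ∨ Equiv.swap a a' i = a') ∧ (k = a ∨ k = a')) := by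
      rwa [swap_mem_pair]
    have hlt : Equiv.swap a a' i < Equiv.swap a a' k ↔ i < k := by
      rw [lt_swap_iff h hadj (by tauto), swap_lt_iff h hadj hik]
    simp only [intraFactor, Function.comp_apply, hlt]

lemma outerFactor_comp_swap_next (h : a < a') (hadj : ∀ k, a < k → ¬k < a') (τ η : ℂ) (ν : ℕ → ℂ)
    {c : Fin n → ℕ} {m : ℕ} (ha : c a < m + 1) (ha' : c a' < m + 1) (T T' : Fin n → ℂ) :
    outerFactor a a' τ η ν c m T (T' ∘ Equiv.swap a a') = outerFactor a a' τ η ν c m T T' := by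
  have hs := color_swap_lt_iff ha ha'
  unfold outerFactor
  congr 1
  refine outerProd_congr (Equiv.refl _) (Equiv.swap a a') (fun _ => Iff.rfl) swap_mem_pair ?_
  intro i k hik
  simp only [interFactor, Function.comp_apply, Equiv.refl_apply, hs]
  split_ifs
  · refine pairPsi_congr (swap_lt_iff h hadj (by tauto)).symm ?_ (fun _ => rfl) _
    rw [eq_comm, @eq_comm _ _ i, swap_eq_iff (by tauto)]
  · rfl

/-- If both `a` and `a'` belong to level `m`, exchanging their variables has no effect off the
pair `{a, a'}`. -/
lemma outerFactor_comp_swap_left (h : a < a') (hadj : ∀ k, a < k → ¬k < a') (τ η : ℂ) (ν : ℕ → ℂ)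
    {c : Fin n → ℕ} {m : ℕ} (ha : c a < m) (ha' : c a' < m) (T T' : Fin n → ℂ) :
    outerFactor a a' τ η ν c m (T ∘ Equiv.swap a a') T' = outerFactor a a' τ η ν c m T T' := by
  have hs := color_swap_lt_iff ha ha'
  unfold outerFactor
  congr 1
  · refine outerProd_congr (Equiv.swap a a') (Equiv.refl _) swap_mem_pair (fun _ => Iff.rfl) ?_
    intro i k hik
    simp only [interFactor, Function.comp_apply, Equiv.refl_apply, hs]
    split_ifs
    · refine pairPsi_congr (lt_swap_iff h hadj hik).symm (swap_eq_iff hik).symm ?_ _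
      rintro rfl
      rw [Equiv.swap_apply_of_ne_of_ne] <;> tauto
    · rfl
  · refine outerProd_congr (Equiv.swap a a') (Equiv.swap a a') swap_mem_pair swap_mem_pair ?_
    intro i k hik
    have hik' : ¬((Equiv.swap a a' i = a ∨ Equiv.swap a a' i = a') ∧ (k = a ∨ k = a')) := by
      rwa [swap_mem_pair]
    have hlt : Equiv.swap a a' i < Equiv.swap a a' k ↔ i < k := by
      rw [lt_swap_iff h hadj (by tauto), swap_lt_iff h hadj hik]
    simp only [intraFactor, Function.comp_apply, hlt, hs]

lemma levelFactor_eq (h : a < a') (τ η : ℂ) (ν : ℕ → ℂ) {c : Fin n → ℕ} {m : ℕ} (ha : c a < m)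
    (ha' : c a' < m) (T T' : Fin n → ℂ) :
    levelFactor τ η ν c m T T' = outerFactor a a' τ η ν c m T T' *
      pairFactor τ η (dyn η ν c m a) (dyn η ν c m a') (T a) (T a') (T' a) (T' a') := by
  have h1 : c a < m + 1 := by omega
  have h2 : c a' < m + 1 := by omega
  have h3 : ¬a' < a := h.not_gt
  unfold levelFactor outerFactor
  rw [prod_eq_outerProd_mul h.ne, prod_eq_outerProd_mul h.ne]
  simp only [interFactor, intraFactor, pairPsi, pairFactor, ha, ha', h1, h2, h3, h, h.ne, h.ne',
    lt_irrefl, and_self, and_false, if_true, if_false]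
  ring

lemma levelFactor_eq_of_fst (h : a < a') (τ η : ℂ) (ν : ℕ → ℂ) {c : Fin n → ℕ} {m : ℕ}
    (ha : c a < m) (ha' : c a' = m) (T T' : Fin n → ℂ) :
    levelFactor τ η ν c m T T' = outerFactor a a' τ η ν c m T T' *
      (theta τ (T' a - T a + dyn η ν c m a) / theta τ (dyn η ν c m a) *
        theta τ (T' a' - T a)) := by
  have h1 : c a < m + 1 := by omega
  have h2 : c a' < m + 1 := by omega
  have h3 : ¬a' < a := h.not_gt
  have h4 : ¬c a' < m := by omega
  unfold levelFactor outerFactor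
  rw [prod_eq_outerProd_mul h.ne, prod_eq_outerProd_mul h.ne]
  simp only [interFactor, intraFactor, pairPsi, ha, h1, h2, h3, h4, h.ne',
    lt_irrefl, and_self, and_true, and_false, if_true, if_false, false_and]
  ring

lemma levelFactor_eq_of_snd (h : a < a') (τ η : ℂ) (ν : ℕ → ℂ) {c : Fin n → ℕ} {m : ℕ}
    (ha : c a = m) (ha' : c a' < m) (T T' : Fin n → ℂ) :
    levelFactor τ η ν c m T T' = outerFactor a a' τ η ν c m T T' *
      (theta τ (η + (T' a - T a')) *
        (theta τ (T' a' - T a' + dyn η ν c m a') / theta τ (dyn η ν c m a'))) := by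
  have h1 : c a < m + 1 := by omega
  have h2 : c a' < m + 1 := by omega
  have h3 : ¬a' < a := h.not_gt
  have h4 : ¬c a < m := by omega
  unfold levelFactor outerFactor
  rw [prod_eq_outerProd_mul h.ne, prod_eq_outerProd_mul h.ne]
  simp only [interFactor, intraFactor, pairPsi, ha', h1, h2, h3, h4, h, h.ne, h.ne',
    lt_irrefl, and_self, and_true, and_false, if_true, if_false]
  ring

end Exchange

/-! ### The exchange relation for weight functions -/

section Exchange

variable {n : ℕ} {a a' : Fin n} {X : ℕ → Type*} [∀ m, Fintype (X m)] [∀ m, DecidableEq (X m)]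

lemma comp_swap_comp_swap {α : Type*} (T : Fin n → α) :
    (T ∘ Equiv.swap a a') ∘ Equiv.swap a a' = T := by
  funext i; simp

/-- Below the first level where both `a` and `a'` occur, exchanging their colors amounts to
exchanging their variables. -/
lemma levelFactor_comp_swap_of_lt (h : a < a') (hadj : ∀ k, a < k → ¬k < a') (τ η : ℂ)
    (ν : ℕ → ℂ) {c : Fin n → ℕ} (hc : c a < c a') {m : ℕ} (hm : m < c a') (T T' : Fin n → ℂ) :
    levelFactor τ η ν (c ∘ Equiv.swap a a') m (T ∘ Equiv.swap a a') T' =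
      levelFactor τ η ν c m T (T' ∘ Equiv.swap a a') := by
  have hlt : ∀ i k : Fin n, i ≠ a' → k ≠ a' →
      (Equiv.swap a a' k < Equiv.swap a a' i ↔ k < i) := by
    intro i k hi hk
    by_cases hik : i = a ∧ k = a
    · simp [hik.1, hik.2]
    · have h1 : ¬((i = a ∨ i = a') ∧ (k = a ∨ k = a')) := by tauto
      have h2 : ¬((i = a ∨ i = a') ∧
        (Equiv.swap a a' k = a ∨ Equiv.swap a a' k = a')) := by rwa [swap_mem_pair]
      rw [lt_swap_iff h hadj h2, swap_lt_iff h hadj (by tauto)]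
  unfold levelFactor
  congr 1
  · rw [← Equiv.prod_comp (Equiv.swap a a')]
    refine prod_congr rfl fun i _ => ?_
    rw [← Equiv.prod_comp (Equiv.swap a a')]
    refine prod_congr rfl fun k _ => ?_
    simp only [interFactor, Function.comp_apply, Equiv.swap_apply_self]
    split_ifs with hik
    · have hi : i ≠ a' := by rintro rfl; omega
      have hk : k ≠ a' := by rintro rfl; omega
      refine pairPsi_congr (hlt i k hi hk) (by simp) ?_ _
      intro _
      by_cases hia : i = a
      · subst hia
        have h1 : ((c ∘ Equiv.swap i a') i = (c ∘ Equiv.swap i a') a') ↔ False := by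
          simp; omega
        have h2 : ((c ∘ Equiv.swap i a') i = m) ↔ False := by
          simp; omega
        rw [Equiv.swap_apply_left, dyn_snd h hadj, dyn_eq, if_neg h1.1, if_neg h2.1,
          dynVar_comp_swap h hadj, dynVar_comp_swap h hadj]
        simp
      · rw [Equiv.swap_apply_of_ne_of_ne hia hi, dyn_comp_swap h hadj _ _ _ _ (by tauto)]
    · rfl
  · rw [← Equiv.prod_comp (Equiv.swap a a')]
    refine prod_congr rfl fun i _ => ?_
    rw [← Equiv.prod_comp (Equiv.swap a a')]
    refine prod_congr rfl fun k _ => ?_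
    simp only [intraFactor, Function.comp_apply, Equiv.swap_apply_self]
    by_cases hik : c i < m ∧ c k < m
    · have hi : i ≠ a' := by rintro rfl; omega
      have hk : k ≠ a' := by rintro rfl; omega
      simp only [hlt k i hk hi]
    · simp only [hik, false_and, if_false]

lemma weight_comp_swap_of_le (h : a < a') (hadj : ∀ k, a < k → ¬k < a') (τ η : ℂ) (ν : ℕ → ℂ)
    (t : ∀ m, X m → ℂ) {c : Fin n → ℕ} (hc : c a < c a') {m : ℕ} (hm : m ≤ c a')
    (T : Fin n → ℂ) :
    weight τ η ν t (c ∘ Equiv.swap a a') m T = weight τ η ν t c m (T ∘ Equiv.swap a a') := by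
  induction m generalizing T with
  | zero => rfl
  | succ m ih =>
    simp only [weight]
    rw [levelSum_reindex (t m) (c := c) (c' := c ∘ Equiv.swap a a')
      (Equiv.swap a a') (fun _ => Iff.rfl)]
    refine levelSum_congr fun e => ?_
    rw [ih (by omega), levelFactor_comp_swap_of_lt h hadj τ η ν hc (by omega),
      comp_swap_comp_swap]

variable {τ η : ℂ} {ν : ℕ → ℂ} {N : ℕ}

/-- Genericity of the dynamical parameters: `ϑ(h^r μ_l / μ_l')` does not vanish for any integer `r` and
distinct labels below `N`. All denominators depending on the dynamical parameters have this form. -/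
def Generic (τ η : ℂ) (ν : ℕ → ℂ) (N : ℕ) : Prop :=
  ∀ (r : ℤ) (l l' : ℕ), l < N → l' < N → l ≠ l' → theta τ (r * η + ν l - ν l') ≠ 0

lemma Generic.dyn_ne_zero (hg : Generic τ η ν N) {c : Fin n → ℕ} {m : ℕ} (hm : m < N) {i : Fin n}
    (hi : c i < m) : theta τ (dyn η ν c m i) ≠ 0 := by
  have := hg (1 + colorCount c (c i) i - colorCount c m i) m (c i) hm (hi.trans hm) hi.ne'
  push_cast at this
  exact this

lemma Generic.dynVar_sub_ne_zero (hg : Generic τ η ν N) (c : Fin n → ℕ) (i : Fin n) {l l' : ℕ}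
    (hl : l < N) (hl' : l' < N) (h : l ≠ l') (r : ℤ) :
    theta τ (r * η + (dynVar η ν c i l - dynVar η ν c i l')) ≠ 0 := by
  have := hg (r + colorCount c l i - colorCount c l' i) l' l hl' hl h.symm
  push_cast at this
  convert this using 2
  simp only [dynVar]; ring

/-- The coefficients pass from the variables `T` of a level containing both `a` and `a'` to the
variables `T'` of the next level. -/
lemma levelFactor_exchange (hτ : 0 < τ.im) (hg : Generic τ η ν N) (h : a < a')
    (hadj : ∀ k, a < k → ¬k < a') {c : Fin n → ℕ} (hc : c a < c a') {m : ℕ} (hm : c a' < m)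
    (hN : m < N) {T T' : Fin n → ℂ} (hT : theta τ (T a' - T a) ≠ 0)
    (hT' : theta τ (T' a' - T' a) ≠ 0) :
    levelFactor τ η ν (c ∘ Equiv.swap a a') m T T' *
          alphaCoeff τ η (dynVar η ν c a (c a) - dynVar η ν c a (c a')) (T a' - T a) +
        levelFactor τ η ν (c ∘ Equiv.swap a a') m (T ∘ Equiv.swap a a') T' *
          betaCoeff τ η (T a - T a') =
      alphaCoeff τ η (dynVar η ν c a (c a) - dynVar η ν c a (c a')) (T' a' - T' a) *
          levelFactor τ η ν c m T T' +
        betaCoeff τ η (T' a' - T' a) * levelFactor τ η ν c m T (T' ∘ Equiv.swap a a') := by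
  have ha : c a < m := hc.trans hm
  have ha1 : (c ∘ Equiv.swap a a') a < m := by simpa using hm
  have ha2 : (c ∘ Equiv.swap a a') a' < m := by simpa using ha
  have d1 : dyn η ν (c ∘ Equiv.swap a a') m a = dyn η ν c m a' := by
    rw [dyn_eq, dyn_snd h hadj, if_neg hc.ne, if_neg ha.ne, dynVar_comp_swap h hadj,
      dynVar_comp_swap h hadj]
    simp
  have d2 : dyn η ν (c ∘ Equiv.swap a a') m a' = dyn η ν c m a := by
    rw [dyn_snd h hadj, dyn_eq η ν c, dynVar_comp_swap h hadj, dynVar_comp_swap h hadj]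
    simp [hc.ne', hm.ne]
  have d3 : dynVar η ν c a (c a) - dynVar η ν c a (c a') = dyn η ν c m a - dyn η ν c m a' := by
    rw [dyn_eq, dyn_snd h hadj, if_neg hc.ne, if_neg ha.ne]
    ring
  have hD := hg.dynVar_sub_ne_zero c a (ha.trans hN) (hm.trans hN) hc.ne 0
  rw [Int.cast_zero, zero_mul, zero_add, d3] at hD
  have o1 : outerFactor a a' τ η ν (c ∘ Equiv.swap a a') m (T ∘ Equiv.swap a a') T' =
      outerFactor a a' τ η ν c m T T' :=
    outerFactor_comp_swap h hadj τ η ν (by omega) (by omega) T T'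
  have o2 : outerFactor a a' τ η ν (c ∘ Equiv.swap a a') m T T' =
      outerFactor a a' τ η ν c m T T' := by
    rw [← o1, outerFactor_comp_swap_left h hadj τ η ν ha1 ha2]
  have o3 : outerFactor a a' τ η ν c m T (T' ∘ Equiv.swap a a') =
      outerFactor a a' τ η ν c m T T' :=
    outerFactor_comp_swap_next h hadj τ η ν (by omega) (by omega) T T'
  rw [levelFactor_eq h τ η ν ha1 ha2, levelFactor_eq h τ η ν ha1 ha2, levelFactor_eq h τ η ν ha hm,
    levelFactor_eq h τ η ν ha hm, o1, o2, o3, d1, d2, d3]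
  simp only [Function.comp_apply, Equiv.swap_apply_left, Equiv.swap_apply_right]
  have key := pairFactor_exchange hτ (η := η) (hg.dyn_ne_zero hN ha) (hg.dyn_ne_zero hN hm) hD
    hT' hT
  linear_combination outerFactor a a' τ η ν c m T T' * key

/-- The exchange relation for the weight functions of two colorings that differ by a transposition
of neighbouring elements. -/
theorem weight_exchange (hτ : 0 < τ.im) (hg : Generic τ η ν N) {t : ∀ m, X m → ℂ}
    (ht : ∀ m x y, x ≠ y → theta τ (t m y - t m x) ≠ 0) (h : a < a')
    (hadj : ∀ k, a < k → ¬k < a') {c : Fin n → ℕ} (hc : c a < c a') {m : ℕ} (hm : c a' < m)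
    (hN : m ≤ N) {T : Fin n → ℂ} (hT : theta τ (T a' - T a) ≠ 0) :
    weight τ η ν t (c ∘ Equiv.swap a a') m T =
      alphaCoeff τ η (dynVar η ν c a (c a) - dynVar η ν c a (c a')) (T a' - T a) *
          weight τ η ν t c m T +
        betaCoeff τ η (T a' - T a) * weight τ η ν t c m (T ∘ Equiv.swap a a') := by
  induction m, Nat.succ_le_of_lt hm using Nat.le_induction generalizing T with
  | base =>
    simp only [weight]
    rw [levelSum_reindex (t (c a')) (c := c) (c' := c ∘ Equiv.swap a a')
      (Equiv.swap a a') (fun _ => Iff.rfl)]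
    simp only [levelSum, mul_sum, ← sum_add_distrib]
    refine sum_congr rfl fun e _ => ?_
    rw [weight_comp_swap_of_le h hadj τ η ν t hc le_rfl, comp_swap_comp_swap]
    set S := assign (t (c a')) e
    have ha1 : (c ∘ Equiv.swap a a') a = c a' := by simp
    have ha2 : (c ∘ Equiv.swap a a') a' < c a' := by simpa using hc
    have hD := hg.dynVar_sub_ne_zero c a (hc.trans hN) hN hc.ne 0
    have hηD := hg.dynVar_sub_ne_zero c a (hc.trans hN) hN hc.ne 1
    rw [Int.cast_zero, zero_mul, zero_add] at hD
    rw [Int.cast_one, one_mul] at hηD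
    rw [levelFactor_eq_of_snd h τ η ν ha1 ha2, levelFactor_eq_of_fst h τ η ν hc rfl,
      levelFactor_eq_of_fst h τ η ν hc rfl,
      outerFactor_comp_swap h hadj τ η ν (by omega) (by omega),
      outerFactor_comp_swap_next h hadj τ η ν (by omega) (by omega)]
    have d1 : dyn η ν (c ∘ Equiv.swap a a') (c a') a' =
        dynVar η ν c a (c a) - dynVar η ν c a (c a') := by
      rw [dyn_snd h hadj, dynVar_comp_swap h hadj, dynVar_comp_swap h hadj]
      simp [hc.ne']
      ring
    rw [d1, dyn_eq, add_sub_assoc]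
    have key := single_exchange hτ (t := S a) hD hηD hT
    simp only [Function.comp_apply, Equiv.swap_apply_left, Equiv.swap_apply_right]
    linear_combination outerFactor a a' τ η ν c (c a') S T * weight τ η ν t c (c a') S * key
  | succ m hcm ih =>
    have hm' : c a' < m := hcm
    have hs := color_swap_lt_iff (c := c) (hc.trans hm') hm'
    simp only [weight]
    rw [levelSum_reindex (t m) (c := c) (c' := c ∘ Equiv.swap a a') (Equiv.refl _) hs]
    have e1 : levelSum (t m) c m (fun S => levelFactor τ η ν (c ∘ Equiv.swap a a') m S T *
        weight τ η ν t (c ∘ Equiv.swap a a') m S) =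
        levelSum (t m) c m (fun S => levelFactor τ η ν (c ∘ Equiv.swap a a') m S T *
          (alphaCoeff τ η (dynVar η ν c a (c a) - dynVar η ν c a (c a')) (S a' - S a) *
            weight τ η ν t c m S)) +
        levelSum (t m) c m (fun S => levelFactor τ η ν (c ∘ Equiv.swap a a') m S T *
          (betaCoeff τ η (S a' - S a) * weight τ η ν t c m (S ∘ Equiv.swap a a'))) := by
      simp only [levelSum, ← sum_add_distrib]
      refine sum_congr rfl fun e _ => ?_
      rw [ih hm' (by omega) (assign_ne (P := fun x y => theta τ (y - x) ≠ 0)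
        (ht m) e (hc.trans hm') hm' h.ne)]
      ring
    have e2 := levelSum_reindex (t m) (c := c) (c' := c) (Equiv.swap a a') (fun i => (hs i).symm)
      (fun S => levelFactor τ η ν (c ∘ Equiv.swap a a') m S T *
          (betaCoeff τ η (S a' - S a) * weight τ η ν t c m (S ∘ Equiv.swap a a')))
    refine e1.trans ?_
    rw [e2]
    simp only [levelSum, mul_sum, ← sum_add_distrib]
    refine sum_congr rfl fun e _ => ?_
    have key := levelFactor_exchange hτ hg h hadj hc hm' (by omega)
      (assign_ne (P := fun x y => theta τ (y - x) ≠ 0) (ht m) e (hc.trans hm') hm' h.ne) hT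
    rw [comp_swap_comp_swap]
    simp only [Function.comp_apply, Equiv.swap_apply_left, Equiv.swap_apply_right]
    linear_combination weight τ η ν t c m (assign (t m) e) * key

lemma levelFactor_symm (hτ : 0 < τ.im) (hg : Generic τ η ν N) (hη : theta τ η ≠ 0) (h : a < a')
    (hadj : ∀ k, a < k → ¬k < a') {c : Fin n → ℕ} (hc : c a = c a') {m : ℕ} (hm : c a < m)
    (hN : m < N) {T T' : Fin n → ℂ} (hT : theta τ (T a' - T a) ≠ 0)
    (hT' : theta τ (T' a' - T' a) ≠ 0) (hT'' : theta τ (T' a' - T' a - η) ≠ 0) :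
    levelFactor τ η ν c m T T' + levelFactor τ η ν c m (T ∘ Equiv.swap a a') T' =
      levelFactor τ η ν c m T (T' ∘ Equiv.swap a a') +
        levelFactor τ η ν c m (T ∘ Equiv.swap a a') (T' ∘ Equiv.swap a a') := by
  have hm' : c a' < m := hc ▸ hm
  have d : dyn η ν c m a' = dyn η ν c m a + η := by
    rw [dyn_snd h hadj, dyn_eq, if_pos hc, if_neg hm.ne, hc]
    ring
  have hB := hg.dyn_ne_zero hN hm'
  rw [d] at hB
  have key := pairFactor_symm hτ hη (hg.dyn_ne_zero hN hm) hB hT' hT'' hT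
  simp only [levelFactor_eq h τ η ν hm hm', d,
    outerFactor_comp_swap_left h hadj τ η ν hm hm',
    outerFactor_comp_swap_next h hadj τ η ν (Nat.lt_succ_of_lt hm) (Nat.lt_succ_of_lt hm'),
    Function.comp_apply, Equiv.swap_apply_left, Equiv.swap_apply_right]
  linear_combination outerFactor a a' τ η ν c m T T' * key

/-- If neither `a` nor `a'` belongs to level `m` and both have the same color, their variables at
the next level play the same role. -/
lemma levelFactor_comp_swap_of_le (h : a < a') (hadj : ∀ k, a < k → ¬k < a') (τ η : ℂ)
    (ν : ℕ → ℂ) {c : Fin n → ℕ} (hc : c a = c a') {m : ℕ} (hm : m ≤ c a) (T T' : Fin n → ℂ) :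
    levelFactor τ η ν c m T (T' ∘ Equiv.swap a a') = levelFactor τ η ν c m T T' := by
  have hcs : ∀ k, c (Equiv.swap a a' k) = c k := by
    intro k
    by_cases h1 : k = a
    · rw [h1, Equiv.swap_apply_left, hc]
    by_cases h2 : k = a'
    · rw [h2, Equiv.swap_apply_right, hc]
    rw [Equiv.swap_apply_of_ne_of_ne h1 h2]
  unfold levelFactor
  congr 1
  refine prod_congr rfl fun i _ => ?_
  rw [← Equiv.prod_comp (Equiv.swap a a')]
  refine prod_congr rfl fun k _ => ?_
  simp only [interFactor, Function.comp_apply, Equiv.swap_apply_self, hcs]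
  split_ifs with hik
  · have hi : ¬(i = a ∨ i = a') := by rintro (rfl | rfl) <;> omega
    refine pairPsi_congr (swap_lt_iff h hadj (by tauto)) ?_ (fun _ => rfl) _
    rw [eq_comm, swap_eq_iff (by tauto), eq_comm]
  · rfl

/-- If `a` and `a'` have the same color, the weight function is symmetric in their variables. -/
theorem weight_symm (hτ : 0 < τ.im) (hg : Generic τ η ν N) (hη : theta τ η ≠ 0)
    {t : ∀ m, X m → ℂ} (ht : ∀ m x y, x ≠ y → theta τ (t m y - t m x) ≠ 0)
    (ht' : ∀ m x y, x ≠ y → theta τ (t m y - t m x - η) ≠ 0) (h : a < a')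
    (hadj : ∀ k, a < k → ¬k < a') {c : Fin n → ℕ} (hc : c a = c a') {m : ℕ}
    (hN : m ≤ N) {T : Fin n → ℂ} (hT : theta τ (T a' - T a) ≠ 0)
    (hT' : theta τ (T a' - T a - η) ≠ 0) :
    weight τ η ν t c m (T ∘ Equiv.swap a a') = weight τ η ν t c m T := by
  induction m generalizing T with
  | zero => rfl
  | succ m ih =>
    simp only [weight]
    by_cases hm : c a < m
    · have hm' : c a' < m := hc ▸ hm
      have hs := color_swap_lt_iff (c := c) hm hm'
      -- Average over the exchange of the two variables of level `m`.
      have hav : ∀ T' : Fin n → ℂ,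
          2 * levelSum (t m) c m (fun S => levelFactor τ η ν c m S T' * weight τ η ν t c m S) =
          levelSum (t m) c m fun S => (levelFactor τ η ν c m S T' +
            levelFactor τ η ν c m (S ∘ Equiv.swap a a') T') * weight τ η ν t c m S := by
        intro T'
        rw [two_mul]
        nth_rewrite 2 [levelSum_reindex (t m) (c := c) (c' := c) (Equiv.swap a a')
          (fun i => (hs i).symm)]
        simp only [levelSum, ← sum_add_distrib]
        refine sum_congr rfl fun e _ => ?_
        rw [ih (by omega)
          (assign_ne (P := fun x y => theta τ (y - x) ≠ 0) (ht m) e hm hm' h.ne)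
          (assign_ne (P := fun x y => theta τ (y - x - η) ≠ 0) (ht' m) e hm hm' h.ne)]
        ring
      apply mul_left_cancel₀ (two_ne_zero' ℂ)
      rw [hav, hav]
      refine levelSum_congr fun e => ?_
      rw [levelFactor_symm hτ hg hη h hadj hc hm (by omega)
        (assign_ne (P := fun x y => theta τ (y - x) ≠ 0) (ht m) e hm hm' h.ne) hT hT']
    · refine levelSum_congr fun e => ?_
      rw [levelFactor_comp_swap_of_le h hadj τ η ν hc (not_lt.1 hm)]

end Exchange

/-! ### The exchange relation solved for the exchanged variables -/

section Exchange

variable {n : ℕ} {a a' : Fin n} {X : ℕ → Type*} [∀ m, Fintype (X m)] [∀ m, DecidableEq (X m)]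
  {τ η : ℂ} {ν : ℕ → ℂ} {N : ℕ}

/-- The coefficient of the weight function of `c ∘ swap a a'` in the exchange relation solved for
the exchanged variables; `lt` tells whether the two colors are in increasing order. -/
def kappaCoeff (τ η D u : ℂ) (lt : Prop) [Decidable lt] : ℂ :=
  if lt then 1 else betaCoeff τ η u * betaCoeff τ η (-u) +
    alphaCoeff τ η D u * alphaCoeff τ η (-D) u

/-- The exchange relation solved for the weight function with exchanged variables, for either order
of the two colors. -/
theorem betaCoeff_mul_weight_comp_swap (hτ : 0 < τ.im) (hg : Generic τ η ν N) {t : ∀ m, X m → ℂ}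
    (ht : ∀ m x y, x ≠ y → theta τ (t m y - t m x) ≠ 0) (h : a < a')
    (hadj : ∀ k, a < k → ¬k < a') {c : Fin n → ℕ} (hc : c a ≠ c a') (hca : c a < N)
    (hca' : c a' < N) {T : Fin n → ℂ} (hT : theta τ (T a' - T a) ≠ 0) :
    betaCoeff τ η (T a' - T a) * weight τ η ν t c N (T ∘ Equiv.swap a a') =
      kappaCoeff τ η (dynVar η ν c a (c a) - dynVar η ν c a (c a')) (T a' - T a) (c a < c a') *
          weight τ η ν t (c ∘ Equiv.swap a a') N T -
        alphaCoeff τ η (dynVar η ν c a (c a) - dynVar η ν c a (c a')) (T a' - T a) *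
          weight τ η ν t c N T := by
  rcases lt_or_gt_of_ne hc with hlt | hgt
  · rw [kappaCoeff, if_pos hlt, weight_exchange hτ hg ht h hadj hlt hca' le_rfl hT]
    ring
  · -- Eliminate the exchanged weight function of `c ∘ swap a a'` from the exchange relation
    -- for that coloring at `T` and at `T ∘ swap a a'`.
    set c' := c ∘ Equiv.swap a a' with hc'
    have e0 : c' a = c a' := by simp [hc']
    have e1 : c' a' = c a := by simp [hc']
    have ecc : c' ∘ Equiv.swap a a' = c := comp_swap_comp_swap c
    have hlt' : c' a < c' a' := by rw [e0, e1]; exact hgt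
    have hT' : theta τ ((T ∘ Equiv.swap a a') a' - (T ∘ Equiv.swap a a') a) ≠ 0 := by
      simp only [Function.comp_apply, Equiv.swap_apply_left, Equiv.swap_apply_right]
      rw [theta_sub_comm]
      exact neg_ne_zero.2 hT
    have r1 := weight_exchange hτ hg ht h hadj hlt' (by rw [e1]; exact hca) le_rfl hT
    have r2 := weight_exchange hτ hg ht h hadj hlt' (by rw [e1]; exact hca) le_rfl hT'
    rw [ecc, e0, e1] at r1 r2
    rw [comp_swap_comp_swap] at r2
    simp only [Function.comp_apply, Equiv.swap_apply_left, Equiv.swap_apply_right] at r2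
    have d : ∀ l, dynVar η ν c' a l = dynVar η ν c a l := fun l => dynVar_comp_swap h hadj η ν c l
    simp only [d] at r1 r2
    set D := dynVar η ν c a (c a) - dynVar η ν c a (c a') with hD
    have hD' : dynVar η ν c a (c a') - dynVar η ν c a (c a) = -D := by rw [hD]; ring
    rw [hD'] at r1 r2
    have hα : alphaCoeff τ η (-D) (T a - T a') = -alphaCoeff τ η D (T a' - T a) := by
      rw [← alphaCoeff_neg, neg_sub (T a') (T a)]
    rw [hα] at r2
    rw [kappaCoeff, if_neg hgt.not_gt, neg_sub]
    linear_combination betaCoeff τ η (T a' - T a) * r2 + alphaCoeff τ η D (T a' - T a) * r1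

end Exchange

/-! ### Evaluation at the diagonal -/

section Evaluation

variable {n : ℕ}

lemma levelFactor_congr (τ η : ℂ) (ν : ℕ → ℂ) {c : Fin n → ℕ} {m : ℕ} {S T S' T' : Fin n → ℂ}
    (h : ∀ i, c i < m → S i = T i) (h' : ∀ i, c i < m + 1 → S' i = T' i) :
    levelFactor τ η ν c m S S' = levelFactor τ η ν c m T T' := by
  unfold levelFactor
  congr 1
  · refine prod_congr rfl fun i _ => prod_congr rfl fun k _ => ?_
    unfold interFactor
    split_ifs with hik
    · rw [h i hik.1, h' k hik.2]
    · rfl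
  · refine prod_congr rfl fun i _ => prod_congr rfl fun k _ => ?_
    unfold intraFactor
    split_ifs with hik
    · rw [h i hik.1.1, h k hik.1.2]
    · rfl

/-- The values `z_I` of the variables: those of level `m` are the `z i` with `I i < m`. -/
def valuesAt (z : Fin n → ℂ) (I : Fin n → ℕ) (m : ℕ) (x : {i // I i < m}) : ℂ := z x.1

lemma weight_valuesAt_comp (τ η : ℂ) (ν : ℕ → ℂ) (z : Fin n → ℂ) (I : Fin n → ℕ)
    (σ : Equiv.Perm (Fin n)) (c : Fin n → ℕ) (m : ℕ) (T : Fin n → ℂ) :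
    weight τ η ν (valuesAt (z ∘ σ) (I ∘ σ)) c m T = weight τ η ν (valuesAt z I) c m T := by
  induction m generalizing T with
  | zero => rfl
  | succ m ih =>
    simp only [weight, levelSum, ih]
    let e : {i // (I ∘ σ) i < m} ≃ {i // I i < m} := σ.subtypeEquiv fun _ => Iff.rfl
    refine (Equiv.sum_comp ((Equiv.refl {i // c i < m}).equivCongr e.symm) _).symm.trans ?_
    refine sum_congr rfl fun f _ => ?_
    have : assign (valuesAt (z ∘ σ) (I ∘ σ) m) ((Equiv.refl {i // c i < m}).equivCongr e.symm f) =
        assign (valuesAt z I m) f := by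
      funext i
      unfold assign
      split_ifs
      · simp [valuesAt, e]
      · rfl
    rw [this]

lemma equiv_apply_eq_self {P Q : Fin n → Prop} (e : {i // P i} ≃ {i // Q i})
    (hle : ∀ x, (e x).1 ≤ x.1)
    (hcl : (∀ i k, i ≤ k → P k → P i) ∨ (∀ i k, i ≤ k → Q i → Q k)) (x : {i // P i}) :
    (e x).1 = x.1 := by
  rcases hcl with hcl | hcl
  · obtain ⟨i, hi⟩ := x
    induction i using WellFoundedLT.induction with
    | ind i ih =>
      by_contra hne
      have hlt : (e ⟨i, hi⟩).1 < i := lt_of_le_of_ne (hle _) hne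
      have hP : P (e ⟨i, hi⟩).1 := hcl _ _ hlt.le hi
      have h1 := ih _ hlt hP
      have h2 := e.injective (Subtype.ext h1)
      exact hne (congrArg Subtype.val h2)
  · suffices h : ∀ (i : Fin n) (hi : Q i), (e.symm ⟨i, hi⟩).1 = i by
      have := h (e x).1 (e x).2
      simp only [Subtype.coe_eta, Equiv.symm_apply_apply] at this
      exact this.symm
    intro i
    induction i using WellFoundedGT.induction with
    | ind i ih =>
      intro hi
      by_contra hne
      have hle' := hle (e.symm ⟨i, hi⟩)
      rw [Equiv.apply_symm_apply] at hle'
      have hlt : i < (e.symm ⟨i, hi⟩).1 := lt_of_le_of_ne hle' (Ne.symm hne)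
      have hQ : Q (e.symm ⟨i, hi⟩).1 := hcl _ _ hlt.le hi
      have h1 := ih _ hlt hQ
      have h2 := e.symm.injective (Subtype.ext h1)
      exact hne (congrArg Subtype.val h2)

/-- Triangularity in the extreme case: if `c` is the first coloring, or `I` the last one, then the
only nonzero term of the symmetrization at `z_I` is the one of the identity, and it occurs only for
`c = I`. -/
lemma weight_valuesAt_eq (τ η : ℂ) (ν : ℕ → ℂ) (z : Fin n → ℂ) {c I : Fin n → ℕ}
    (hcl : Monotone c ∨ Antitone I) (m : ℕ) (hI : ∀ i, I i < m ↔ c i < m) {T : Fin n → ℂ}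
    (hT : ∀ i, c i < m → T i = z i) :
    weight τ η ν (valuesAt z I) c m T =
      if ∀ l < m, ∀ i, I i < l ↔ c i < l then ∏ l ∈ range m, levelFactor τ η ν c l z z else 0 := by
  induction m generalizing T with
  | zero => simp [weight]
  | succ m ih =>
    simp only [weight]
    -- A nonzero term forces the assignment to be the identity.
    have hid : ∀ e : {i // c i < m} ≃ {i // I i < m},
        levelFactor τ η ν c m (assign (valuesAt z I m) e) T ≠ 0 → ∀ x, (e x).1 = x.1 := by
      intro e hne
      refine equiv_apply_eq_self e (fun x => ?_) ?_
      · by_contra hlt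
        rw [not_le] at hlt
        apply hne
        have hk : c (e x).1 < m + 1 := (hI _).1 ((e x).2.trans (Nat.lt_succ_self m))
        refine mul_eq_zero_of_left (prod_eq_zero (mem_univ x.1)
          (prod_eq_zero (mem_univ (e x).1) ?_)) _
        simp only [interFactor, x.2, hk, and_self, if_true, pairPsi, hlt.not_gt, hlt.ne', if_false,
          assign, dif_pos, valuesAt, hT _ hk, sub_self, theta_zero]
      · rcases hcl with h | h
        · exact Or.inl fun i k hik hk => (h hik).trans_lt hk
        · exact Or.inr fun i k hik hi => (h hik).trans_lt hi
    by_cases hm : ∀ i, I i < m ↔ c i < m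
    · let e₀ : {i // c i < m} ≃ {i // I i < m} := Equiv.subtypeEquivRight fun i => (hm i).symm
      have hT₀ : ∀ i, c i < m → assign (valuesAt z I m) e₀ i = z i := by
        intro i hi
        simp [assign, hi, valuesAt, e₀]
      unfold levelSum
      rw [sum_eq_single e₀]
      · beta_reduce
        rw [ih hm hT₀, levelFactor_congr τ η ν hT₀ hT, prod_range_succ, mul_ite, mul_zero, mul_comm]
        refine if_congr ⟨fun h l hl => ?_, fun h l hl => h l (by omega)⟩ rfl rfl
        rcases Nat.lt_succ_iff_lt_or_eq.1 hl with hl | rfl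
        · exact h l hl
        · exact hm
      · intro e _ he
        by_contra hne
        apply he
        ext x
        rw [hid e (left_ne_zero_of_mul hne) x]
        rfl
      · simp
    · rw [if_neg fun h => hm (h m (Nat.lt_succ_self m))]
      refine sum_eq_zero fun e _ => ?_
      by_contra hne
      have he := hid e (left_ne_zero_of_mul hne)
      refine hm fun i => ⟨fun hi => ?_, fun hi => ?_⟩
      · have h1 := he (e.symm ⟨i, hi⟩)
        rw [Equiv.apply_symm_apply] at h1
        have h2 := (e.symm ⟨i, hi⟩).2
        rwa [← h1] at h2
      · have h1 := he ⟨i, hi⟩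
        have h2 := (e ⟨i, hi⟩).2
        rwa [h1] at h2

lemma weight_valuesAt_top (τ η : ℂ) (ν : ℕ → ℂ) (z : Fin n → ℂ) {c I : Fin n → ℕ}
    (hcl : Monotone c ∨ Antitone I) {N : ℕ} (hc : ∀ i, c i < N) (hI : ∀ i, I i < N) :
    weight τ η ν (valuesAt z I) c N z =
      if c = I then ∏ l ∈ range N, levelFactor τ η ν c l z z else 0 := by
  rw [weight_valuesAt_eq τ η ν z hcl N (fun i => iff_of_true (hI i) (hc i)) fun _ _ => rfl]
  refine if_congr ⟨fun h => ?_, fun h l _ i => by rw [h]⟩ rfl rfl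
  funext i
  by_contra hne
  rcases lt_or_gt_of_ne hne with hlt | hgt
  · exact absurd ((h (I i) (hI i) i).2 hlt) (lt_irrefl _)
  · exact absurd ((h (c i) (hc i) i).1 hgt) (lt_irrefl _)

/-- The product of `ϑ(h z_k / z_i)` over all pairs at level `m`. -/
def levelE (τ η : ℂ) (z : Fin n → ℂ) (c : Fin n → ℕ) (m : ℕ) : ℂ :=
  ∏ i, ∏ k, if c i < m ∧ c k < m then theta τ (η + z k - z i) else 1

/-- The product of `ϑ(h z_k / z_i)` over `c i < m` and `c k = m`; for `η = 0`, that of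
`ϑ(z_k / z_i)`. -/
def levelQ (τ η : ℂ) (z : Fin n → ℂ) (c : Fin n → ℕ) (m : ℕ) : ℂ :=
  ∏ i, ∏ k, if c i < m ∧ c k = m then theta τ (η + z k - z i) else 1

lemma pow_mul_levelFactor {τ η : ℂ} {ν : ℕ → ℂ} {N : ℕ} (hg : Generic τ η ν N) {z : Fin n → ℂ}
    (hz : ∀ a b, a ≠ b → theta τ (z b - z a) ≠ 0) {c : Fin n → ℕ} {m : ℕ} (hm : m < N) (ε : ℂ)
    (hε : ∀ i k, c i < m → c k = m → (k < i → ε = η) ∧ (i < k → ε = 0)) :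
    theta τ η ^ #{i | c i < m} * levelFactor τ η ν c m z z =
      levelE τ η z c m * levelQ τ ε z c m := by
  have hdiag : theta τ η ^ #{i | c i < m} =
      ∏ i, ∏ k, if k = i then (if c i < m then theta τ η else 1) else 1 := by
    simp only [prod_ite_eq', mem_univ, if_true]
    rw [prod_ite, prod_const, prod_const_one, mul_one]
  unfold levelFactor levelE levelQ
  rw [hdiag]
  simp only [← prod_mul_distrib]
  refine prod_congr rfl fun i _ => prod_congr rfl fun k _ => ?_
  by_cases hi : c i < m
  swap
  · simp [interFactor, intraFactor, hi]
  have hi1 : c i < m + 1 := by omega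
  rcases lt_trichotomy k i with hki | rfl | hki
  · by_cases hk : c k < m
    · have hk1 : c k < m + 1 := by omega
      have hk2 : c k ≠ m := hk.ne
      simp [interFactor, intraFactor, hi, hk, hk1, hk2, pairPsi, hki, hki.ne, hki.not_gt,
        add_sub_assoc]
    · by_cases hk2 : c k = m
      · rw [(hε i k hi hk2).1 hki]
        simp [interFactor, intraFactor, hi, hk2, pairPsi, hki, hki.ne, add_sub_assoc]
      · have hk1 : ¬c k < m + 1 := by omega
        simp [interFactor, intraFactor, hk, hk1, hk2, hki.ne]
  · have hd := hg.dyn_ne_zero hm hi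
    simp [interFactor, intraFactor, hi, hi1, hi.ne, pairPsi, hd]
  · have hne := hz i k hki.ne
    by_cases hk : c k < m
    · have hk1 : c k < m + 1 := by omega
      have hk2 : c k ≠ m := hk.ne
      simp only [interFactor, intraFactor, hi, hk, hk1, hk2, pairPsi, hki, hki.ne', hki.not_gt,
        and_self, and_false, if_true, if_false, add_sub_assoc]
      field_simp
    · by_cases hk2 : c k = m
      · rw [(hε i k hi hk2).2 hki]
        simp [interFactor, intraFactor, hi, hk2, pairPsi, hki.ne', hki.not_gt]
      · have hk1 : ¬c k < m + 1 := by omega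
        simp [interFactor, intraFactor, hk, hk1, hk2, hki.ne']

end Evaluation

/-! ### Weight functions of partitions and of colorings -/

/-- A sum over families of indices of a product of factors that couple neighbouring indices,
summed one index at a time. -/
lemma eq_sum_pi_prod {V : Type*} {P : ℕ → Type*} [∀ k, Fintype (P k)] [∀ k, DecidableEq (P k)]
    (ev : ∀ k, P k → V) (G : ℕ → V → V → ℂ) (w : ℕ → V → ℂ) (h0 : ∀ v, w 0 v = 1)
    (hs : ∀ k v, w (k + 1) v = ∑ p : P k, G k (ev k p) v * w k (ev k p)) (M : ℕ) (v : V) :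
    w M v = ∑ s : (k : Fin M) → P k, ∏ k : Fin M, G k (ev k (s k))
      (if h : k.val + 1 < M then ev (k.val + 1) (s ⟨k.val + 1, h⟩) else v) := by
  induction M generalizing v with
  | zero => simp [h0]
  | succ M ih =>
    rw [hs, ← (Fin.snocEquiv fun k : Fin (M + 1) => P k).sum_comp, Fintype.sum_prod_type]
    refine sum_congr rfl fun p _ => ?_
    rw [ih, mul_sum]
    refine sum_congr rfl fun s _ => ?_
    have hlast : ∀ (j : ℕ) (hj : j < M + 1), j = M → ev M p =
        ev j (Fin.snoc (α := fun k : Fin (M + 1) => P k) s p ⟨j, hj⟩) := by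
      rintro _ hj rfl
      exact congrArg (ev _) (Fin.snoc_last (α := fun k : Fin (_ + 1) => P k) p s).symm
    rw [Fin.prod_univ_castSucc, mul_comm]
    congr 1
    · refine prod_congr rfl fun k _ => ?_
      have h1 : k.castSucc.val + 1 < M + 1 := by simp
      rw [dif_pos h1]
      simp only [Fin.snocEquiv, Equiv.coe_fn_mk, Fin.snoc_castSucc]
      congr 1
      by_cases hk : k.val + 1 < M
      · rw [dif_pos hk]
        have : (⟨k.castSucc.val + 1, h1⟩ : Fin (M + 1)) = Fin.castSucc ⟨k.val + 1, hk⟩ := rfl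
        exact congrArg (ev (k.val + 1)) (Fin.snoc_castSucc (α := fun k : Fin (M + 1) => P k)
          p s ⟨k.val + 1, hk⟩).symm
      · rw [dif_neg hk]
        exact hlast _ h1 (by simp; omega)
    · simp [Fin.snocEquiv]

variable {N : ℕ} {lam : Fin N → ℕ}

/-- The coloring whose color classes are the blocks of `I`. -/
def Part.color (I : Part lam) (i : Fin (total lam)) : ℕ := (I.1 i).val

lemma Part.color_lt (I : Part lam) (i : Fin (total lam)) : I.color i < N := (I.1 i).isLt

/-- The dynamical parameters, extended by zero to all labels. -/
def extendDyn (ν : Fin N → ℂ) (l : ℕ) : ℂ := if h : l < N then ν ⟨l, h⟩ else 0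

@[simp] lemma extendDyn_val (ν : Fin N → ℂ) (l : Fin N) : extendDyn ν l.val = ν l := by
  simp [extendDyn]

lemma prod_elt (I : Part lam) (m : ℕ) (f : Fin (total lam) → ℂ) :
    ∏ a, f (elt I m a) = ∏ i, if I.color i < m then f i else 1 := by
  rw [← prod_filter]
  have h : univ.map (elt I m).toEmbedding = ({i | I.color i < m} : Finset _) := by
    exact map_orderEmbOfFin_univ (blocksUpTo I m) (card_blocksUpTo I m)
  rw [← h, prod_map]
  rfl

lemma color_elt_lt (I : Part lam) (m : ℕ) (a : Fin (cum lam m)) : I.color (elt I m a) < m := by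
  have : elt I m a ∈ blocksUpTo I m := orderEmbOfFin_mem _ _ a
  simpa [blocksUpTo, Part.color] using this

lemma elt_of_le (I : Part lam) {m : ℕ} (hm : N ≤ m) (a : Fin (cum lam m)) :
    elt I m a = Fin.castLE (cum_le lam m) a := by
  have h := orderEmbOfFin_unique (s := blocksUpTo I m) (card_blocksUpTo I m)
    (f := Fin.castLE (cum_le lam m))
    (fun x => by simp only [blocksUpTo, mem_filter, mem_univ, true_and]
                 exact (I.color_lt _).trans_le hm)
    (Fin.strictMono_castLE _)
  exact (congrFun h a).symm

lemma dynArg_eq (I : Part lam) (η : ℂ) (ν : Fin N → ℂ) (k : Fin (N - 1))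
    (a : Fin (cum lam (k + 1))) :
    dynArg I η ν k a = dyn η (extendDyn ν) I.color (k + 1) (elt I (k + 1) a) := by
  have hp : ∀ (j : Fin N) i, pcount I j i = colorCount I.color j.val i := by
    intro j i
    unfold pcount colorCount block
    rw [filter_filter]
    congr 1
    ext b
    simp only [mem_filter, mem_univ, true_and]
    simp only [Part.color, Fin.ext_iff]
  have h1 : extendDyn ν (k + 1) = ν (nextLabel k) := extendDyn_val ν (nextLabel k)
  have h2 : extendDyn ν (I.color (elt I (k + 1) a)) = ν (I.1 (elt I (k + 1) a)) :=
    extendDyn_val ν _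
  simp only [dynArg, dyn, hp, h1, h2]
  rfl

lemma mem_blocksUpTo_iff (I : Part lam) (m : ℕ) (i : Fin (total lam)) :
    i ∈ blocksUpTo I m ↔ I.color i < m := by
  simp [blocksUpTo, Part.color]

/-- The increasing enumeration of `I_1 ∪ … ∪ I_m` as a bijection. -/
def eltIso (I : Part lam) (m : ℕ) : Fin (cum lam m) ≃ {i // I.color i < m} :=
  ((blocksUpTo I m).orderIsoOfFin (card_blocksUpTo I m)).toEquiv.trans
    (Equiv.subtypeEquivRight (mem_blocksUpTo_iff I m))

@[simp] lemma coe_eltIso (I : Part lam) (m : ℕ) (a : Fin (cum lam m)) :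
    (eltIso I m a).1 = elt I m a := rfl

/-- The bijections of the elements of the first `m` blocks of `J` and of `I`, in terms of the
positions of these elements. -/
def eltEquiv (J I : Part lam) (m : ℕ) :
    Equiv.Perm (Fin (cum lam m)) ≃ ({i // J.color i < m} ≃ {i // I.color i < m}) :=
  Equiv.equivCongr (eltIso J m) (eltIso I m)

lemma assign_eltEquiv (J I : Part lam) (m : ℕ) (z : Fin (total lam) → ℂ)
    (s : Equiv.Perm (Fin (cum lam m))) (a : Fin (cum lam m)) :
    assign (valuesAt z I.color m) (eltEquiv J I m s) (elt J m a) = z (elt I m (s a)) := by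
  have h : (⟨elt J m a, color_elt_lt J m a⟩ : {i // J.color i < m}) = eltIso J m a := rfl
  simp only [assign, color_elt_lt, dif_pos, h, eltEquiv, Equiv.equivCongr_apply_apply,
    Equiv.symm_apply_apply, valuesAt, coe_eltIso]

lemma levelFactor_eq_prod_elt (τ η : ℂ) (ν : Fin N → ℂ) (J : Part lam) (k : Fin (N - 1))
    (S S' : Fin (total lam) → ℂ) :
    levelFactor τ η (extendDyn ν) J.color (k + 1) S S' =
      ∏ a : Fin (cum lam (k + 1)), ((∏ c : Fin (cum lam (k + 2)),
        psi τ J η ν k a c (S' (elt J (k + 2) c) - S (elt J (k + 1) a))) *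
      ∏ b : Fin (cum lam (k + 1)) with a < b,
        theta τ (η + S (elt J (k + 1) b) - S (elt J (k + 1) a)) /
          theta τ (S (elt J (k + 1) b) - S (elt J (k + 1) a))) := by
  have h1 : ∏ i, ∏ j, interFactor τ η (extendDyn ν) J.color (k + 1) S S' i j =
      ∏ a : Fin (cum lam (k + 1)), ∏ c : Fin (cum lam (k + 2)),
        psi τ J η ν k a c (S' (elt J (k + 2) c) - S (elt J (k + 1) a)) := by
    have e : ∀ a c, psi τ J η ν k a c (S' (elt J (k + 2) c) - S (elt J (k + 1) a)) =
        pairPsi τ η (extendDyn ν) J.color (k + 1) (elt J (k + 1) a) (elt J (k + 2) c)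
          (S' (elt J (k + 2) c) - S (elt J (k + 1) a)) := fun a c => by
      simp only [psi, pairPsi, dynArg_eq]
    simp only [e]
    rw [prod_congr rfl fun a _ => prod_elt J (k + 2) (fun j =>
      pairPsi τ η (extendDyn ν) J.color (k + 1) (elt J (k + 1) a) j (S' j - S (elt J (k + 1) a)))]
    rw [prod_elt J (k + 1) (fun i => ∏ j, if J.color j < k + 2 then
      pairPsi τ η (extendDyn ν) J.color (k + 1) i j (S' j - S i) else 1)]
    refine prod_congr rfl fun i _ => ?_
    simp only [interFactor, ite_and]
    split_ifs
    · rfl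
    · exact prod_const_one
  have h2 : ∏ i, ∏ j, intraFactor τ η J.color (k + 1) S i j =
      ∏ a : Fin (cum lam (k + 1)), ∏ b : Fin (cum lam (k + 1)) with a < b,
        theta τ (η + S (elt J (k + 1) b) - S (elt J (k + 1) a)) /
          theta τ (S (elt J (k + 1) b) - S (elt J (k + 1) a)) := by
    have e : ∀ a b : Fin (cum lam (k + 1)), a < b ↔ elt J (k + 1) a < elt J (k + 1) b :=
      fun a b => (elt J (k + 1)).lt_iff_lt.symm
    simp only [prod_filter, e]
    rw [prod_congr rfl fun a _ => prod_elt J (k + 1) (fun j => if elt J (k + 1) a < j then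
      theta τ (η + S j - S (elt J (k + 1) a)) / theta τ (S j - S (elt J (k + 1) a)) else 1)]
    rw [prod_elt J (k + 1) (fun i => ∏ j, if J.color j < k + 1 then if i < j then
      theta τ (η + S j - S i) / theta τ (S j - S i) else 1 else 1)]
    refine prod_congr rfl fun i _ => ?_
    simp only [intraFactor, ite_and, add_sub_assoc]
    split_ifs
    · rfl
    · exact prod_const_one
  rw [levelFactor, h1, h2, ← prod_mul_distrib]

lemma weight_one (τ η : ℂ) (ν : ℕ → ℂ) {n : ℕ} (z : Fin n → ℂ) (I c : Fin n → ℕ) (T : Fin n → ℂ) :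
    weight τ η ν (valuesAt z I) c 1 T = 1 := by
  simp only [weight, levelSum, mul_one]
  have : ∀ S : Fin n → ℂ, levelFactor τ η ν c 0 S T = 1 := fun S => by
    simp [levelFactor, interFactor, intraFactor]
  simp only [this, sum_const, nsmul_eq_mul, mul_one]
  have hu : Fintype.card ({i // c i < 0} ≃ {i // I i < 0}) = 1 := by
    rw [Fintype.card_eq_one_iff]
    refine ⟨⟨fun x => absurd x.2 (Nat.not_lt_zero _), fun x => absurd x.2 (Nat.not_lt_zero _),
      fun x => absurd x.2 (Nat.not_lt_zero _), fun x => absurd x.2 (Nat.not_lt_zero _)⟩, ?_⟩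
    intro e
    ext x
    exact absurd x.2 (Nat.not_lt_zero _)
  rw [card_univ, hu, Nat.cast_one]

/-- The elliptic weight function at `z_I` in terms of colorings. -/
theorem W_zSub (τ : ℂ) (J I : Part lam) (z T : Fin (total lam) → ℂ) (η : ℂ) (ν : Fin N → ℂ) :
    W τ J (zSub z I) T η ν = theta τ η ^ (∑ k : Fin (N - 1), cum lam (k + 1)) *
      weight τ η (extendDyn ν) (valuesAt z I.color) J.color N T := by
  unfold W
  congr 1
  rcases Nat.eq_zero_or_pos N with rfl | hN
  · simp [U, weight]
  have hN1 : N - 1 + 1 = N := by omega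
  have key := eq_sum_pi_prod (V := Fin (total lam) → ℂ)
    (P := fun k => Equiv.Perm (Fin (cum lam (k + 1))))
    (fun k s => assign (valuesAt z I.color (k + 1)) (eltEquiv J I (k + 1) s))
    (fun k S S' => levelFactor τ η (extendDyn ν) J.color (k + 1) S S')
    (fun k => weight τ η (extendDyn ν) (valuesAt z I.color) J.color (k + 1))
    (fun v => weight_one _ _ _ _ _ _ _)
    (fun k v => ((eltEquiv J I (k + 1)).sum_comp (fun e =>
      levelFactor τ η (extendDyn ν) J.color (k + 1) (assign (valuesAt z I.color (k + 1)) e) v *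
        weight τ η (extendDyn ν) (valuesAt z I.color) J.color (k + 1)
          (assign (valuesAt z I.color (k + 1)) e))).symm)
    (N - 1) T
  rw [hN1] at key
  rw [key]
  refine sum_congr rfl fun s _ => prod_congr rfl fun k _ => ?_
  rw [levelFactor_eq_prod_elt]
  have hnext : ∀ c, nextVar (fun k a => zSub z I k (s k a)) T k c =
      (if h : k.val + 1 < N - 1 then assign (valuesAt z I.color (k.val + 1 + 1))
        (eltEquiv J I (k.val + 1 + 1) (s ⟨k.val + 1, h⟩)) else T) (elt J (k + 2) c) := by
    intro c
    unfold nextVar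
    split_ifs with h
    · exact (assign_eltEquiv J I (k.val + 1 + 1) z (s ⟨k.val + 1, h⟩) c).symm
    · rw [elt_of_le J (by omega)]
  simp only [hnext, assign_eltEquiv]
  rfl

end EllipticWeight

namespace EllipticWeight

/-! ### The orthogonality relation for generic dynamical parameters -/

section Norm

variable {n : ℕ}

lemma levelE_comp (τ η : ℂ) (z : Fin n → ℂ) (c : Fin n → ℕ) (m : ℕ) (σ : Equiv.Perm (Fin n)) :
    levelE τ η (z ∘ σ) (c ∘ σ) m = levelE τ η z c m := by
  unfold levelE
  conv_rhs => rw [← Equiv.prod_comp σ]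
  refine prod_congr rfl fun i _ => ?_
  conv_rhs => rw [← Equiv.prod_comp σ]
  rfl

lemma levelQ_comp (τ η : ℂ) (z : Fin n → ℂ) (c : Fin n → ℕ) (m : ℕ) (σ : Equiv.Perm (Fin n)) :
    levelQ τ η (z ∘ σ) (c ∘ σ) m = levelQ τ η z c m := by
  unfold levelQ
  conv_rhs => rw [← Equiv.prod_comp σ]
  refine prod_congr rfl fun i _ => ?_
  conv_rhs => rw [← Equiv.prod_comp σ]
  rfl

lemma card_comp_lt (c : Fin n → ℕ) (m : ℕ) (σ : Equiv.Perm (Fin n)) :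
    #{i | (c ∘ σ) i < m} = #{i | c i < m} :=
  card_equiv σ fun i => by simp

/-- The norm of the summand at a coloring: the factors of the orthogonality relation other than
the two symmetrizations. -/
def normFactor (τ η : ℂ) (N : ℕ) (z : Fin n → ℂ) (c : Fin n → ℕ) : ℂ :=
  ∏ m ∈ range N, (theta τ η ^ #{i | c i < m}) ^ 2 /
    (levelE τ η z c m ^ 2 * (levelQ τ 0 z c m * levelQ τ η z c m))

lemma normFactor_comp (τ η : ℂ) (N : ℕ) (z : Fin n → ℂ) (c : Fin n → ℕ)
    (σ : Equiv.Perm (Fin n)) : normFactor τ η N (z ∘ σ) (c ∘ σ) = normFactor τ η N z c := by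
  simp only [normFactor, levelE_comp, levelQ_comp, card_comp_lt]

lemma prod_range_levelQ (τ η : ℂ) (N : ℕ) (z : Fin n → ℂ) {c : Fin n → ℕ} (hc : ∀ i, c i < N) :
    ∏ m ∈ range N, levelQ τ η z c m =
      ∏ i, ∏ k, if c i < c k then theta τ (η + z k - z i) else 1 := by
  unfold levelQ
  rw [Finset.prod_comm]
  refine prod_congr rfl fun i _ => ?_
  rw [Finset.prod_comm]
  refine prod_congr rfl fun k _ => ?_
  rw [prod_eq_single (c k)]
  · simp
  · intro m _ hm
    rw [if_neg]
    rintro ⟨-, rfl⟩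
    exact hm rfl
  · intro h
    exact absurd (mem_range.2 (hc k)) h

lemma colorCount_add_rev (c : Fin n → ℕ) (l : ℕ) (i : Fin n) :
    colorCount c l i + colorCount (c ∘ Fin.revPerm) l (Fin.revPerm i) +
      (if c i = l then 1 else 0) = #{b | c b = l} := by
  have h1 : colorCount (c ∘ Fin.revPerm) l (Fin.revPerm i) = #{b | c b = l ∧ i < b} :=
    card_equiv Fin.revPerm fun b => by
      simp only [mem_filter, mem_univ, true_and, Function.comp_apply, Fin.revPerm_apply]
      rw [← Fin.rev_lt_rev, Fin.rev_rev]
  have h2 : (if c i = l then 1 else 0) = #{b | c b = l ∧ b = i} := by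
    split_ifs with h
    · rw [eq_comm, card_eq_one]
      exact ⟨i, by ext b; simp; rintro rfl; exact h⟩
    · rw [eq_comm, card_eq_zero]
      ext b; simp; rintro h' rfl; exact h h'
  rw [h1, h2, colorCount, ← card_union_of_disjoint, ← card_union_of_disjoint]
  · congr 1
    ext b
    simp only [mem_union, mem_filter, mem_univ, true_and]
    grind
  · rw [disjoint_left]
    intro b
    simp only [mem_union, mem_filter, mem_univ, true_and]
    grind
  · rw [disjoint_left]
    intro b
    simp only [mem_filter, mem_univ, true_and]
    grind

end Norm

variable {N : ℕ} {lam : Fin N → ℕ}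

lemma card_color_lt (I : Part lam) (m : ℕ) : #{i | I.color i < m} = cum lam m :=
  card_blocksUpTo I m

lemma prod_range_eq_prod_fin {f : ℕ → ℂ} (h0 : f 0 = 1) :
    ∏ m ∈ range N, f m = ∏ k : Fin (N - 1), f (k + 1) := by
  rcases N with _ | M
  · simp
  · rw [prod_range_succ', h0, mul_one, ← Fin.prod_univ_eq_prod_range (fun m => f (m + 1))]
    rfl

lemma E_zSub (τ η : ℂ) (z : Fin (total lam) → ℂ) (I : Part lam) :
    E τ (zSub z I) η = ∏ m ∈ range N, levelE τ η z I.color m := by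
  rw [prod_range_eq_prod_fin (by simp [levelE])]
  refine prod_congr rfl fun k _ => ?_
  unfold zSub
  rw [prod_congr rfl fun a _ => prod_elt I (k + 1)
    (fun j => theta τ (η + z j - z (elt I (k + 1) a))), prod_elt I (k + 1)
    (fun i => ∏ j, if I.color j < k + 1 then theta τ (η + z j - z i) else 1)]
  refine prod_congr rfl fun i _ => ?_
  simp only [ite_and]
  split_ifs
  · rfl
  · exact prod_const_one.symm

lemma prod_block_eq (I : Part lam) (f : Fin (total lam) → Fin (total lam) → ℂ) :
    ∏ k : Fin N, ∏ l : Fin N with k < l, ∏ a ∈ block I k, ∏ b ∈ block I l, f a b =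
      ∏ i, ∏ k, if I.color i < I.color k then f i k else 1 := by
  have h1 : ∀ k : Fin N, ∏ l : Fin N with k < l, ∏ a ∈ block I k, ∏ b ∈ block I l, f a b =
      ∏ a with I.1 a = k, ∏ l : Fin N, ∏ b with I.1 b = l, if I.1 a < I.1 b then f a b else 1 := by
    intro k
    rw [Finset.prod_comm]
    refine prod_congr rfl fun a ha => ?_
    have hk : I.1 a = k := (mem_filter.1 ha).2
    rw [prod_filter]
    refine prod_congr rfl fun l _ => ?_
    split_ifs with hl
    · refine prod_congr rfl fun b hb => ?_
      have hb' : I.1 b = l := (mem_filter.1 hb).2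
      rw [if_pos (by rwa [hk, hb'])]
    · refine (prod_eq_one fun b hb => ?_).symm
      have hb' : I.1 b = l := (mem_filter.1 hb).2
      rw [if_neg (by rwa [hk, hb'])]
  simp only [h1]
  rw [prod_fiberwise]
  refine prod_congr rfl fun i _ => ?_
  rw [prod_fiberwise]
  rfl

lemma R_eq (τ : ℂ) (z : Fin (total lam) → ℂ) (I : Part lam) :
    R τ z I = ∏ m ∈ range N, levelQ τ 0 z I.color m := by
  rw [prod_range_levelQ τ 0 N z I.color_lt, R, prod_block_eq I (fun a b => theta τ (z b - z a))]
  simp only [zero_add]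

lemma Q_eq (τ η : ℂ) (z : Fin (total lam) → ℂ) (I : Part lam) :
    Q τ z η I = ∏ m ∈ range N, levelQ τ η z I.color m := by
  rw [prod_range_levelQ τ η N z I.color_lt, Q,
    prod_block_eq I (fun a b => theta τ (η + z b - z a))]

lemma Generic.dual {τ η : ℂ} {ν : Fin N → ℂ} (hg : Generic τ η (extendDyn ν) N) :
    Generic τ η (extendDyn (dualDyn lam η ν)) N := by
  intro r l l' hl hl' hne
  have := hg (r + lam ⟨l, hl⟩ - lam ⟨l', hl'⟩) l' l hl' hl hne.symm
  simp only [extendDyn, hl, hl', dif_pos, dualDyn] at this ⊢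
  convert this using 2
  push_cast
  ring

/-- The left hand side of the orthogonality relation. -/
def pairing (τ η : ℂ) (ν : Fin N → ℂ) (J K : Part lam) (z : Fin (total lam) → ℂ) : ℂ :=
  ∑ I : Part lam, weight τ η (extendDyn ν) (valuesAt z I.color) J.color N z *
    weight τ η (extendDyn (dualDyn lam η ν)) (valuesAt z I.color) (K.color ∘ Fin.revPerm) N
      (z ∘ Fin.revPerm) * normFactor τ η N z I.color

lemma sum_Wtilde_eq_pairing (τ η : ℂ) (ν : Fin N → ℂ) (J K : Part lam)
    (z : Fin (total lam) → ℂ) :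
    ∑ I : Part lam, Wtilde τ 1 J (zSub z I) z η ν *
          Wtilde τ Fin.revPerm K (zSub z I) z η (dualDyn lam η ν) / (R τ z I * Q τ z η I) =
      pairing τ η ν J K z := by
  refine sum_congr rfl fun I _ => ?_
  have hpow : theta τ η ^ (∑ k : Fin (N - 1), cum lam (k + 1)) =
      ∏ m ∈ range N, theta τ η ^ #{i | I.color i < m} := by
    rw [prod_range_eq_prod_fin (by simp), ← prod_pow_eq_pow_sum]
    exact prod_congr rfl fun k _ => by rw [card_color_lt]
  have e1 : (permInv 1 J : Part lam) = J := rfl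
  have e2 : (permInv Fin.revPerm K : Part lam).color = K.color ∘ Fin.revPerm := rfl
  unfold Wtilde Wperm
  rw [W_zSub, W_zSub, E_zSub, R_eq, Q_eq, hpow, e1, e2]
  simp only [normFactor, prod_div_distrib, prod_mul_distrib, prod_pow]
  simp only [Equiv.Perm.one_apply]
  change _ / _ * (_ * weight _ _ _ _ _ _ (z ∘ Fin.revPerm) / _) / _ = _
  ring

lemma color_injective : Function.Injective (Part.color (lam := lam)) := by
  intro I J h
  apply Subtype.ext
  funext i
  exact Fin.ext (congrFun h i)

/-- Nondegeneracy of the variables `z`. -/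
structure Nondegenerate {n : ℕ} (τ η : ℂ) (z : Fin n → ℂ) : Prop where
  sub_ne_zero : ∀ a b, a ≠ b → theta τ (z b - z a) ≠ 0
  shift_ne_zero : ∀ a b, theta τ (η + z b - z a) ≠ 0

lemma Nondegenerate.comp {n : ℕ} {τ η : ℂ} {z : Fin n → ℂ} (h : Nondegenerate τ η z)
    (σ : Equiv.Perm (Fin n)) : Nondegenerate τ η (z ∘ σ) :=
  ⟨fun _ _ hab => h.1 _ _ (σ.injective.ne hab), fun _ _ => h.2 _ _⟩

lemma Nondegenerate.neg_shift_ne_zero {n : ℕ} {τ η : ℂ} {z : Fin n → ℂ}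
    (h : Nondegenerate τ η z) (a b : Fin n) : theta τ (z b - z a - η) ≠ 0 := by
  have : z b - z a - η = -(η + z a - z b) := by ring
  rw [this, theta_neg]
  exact neg_ne_zero.2 (h.2 _ _)

lemma levelE_ne_zero {n : ℕ} {τ η : ℂ} {z : Fin n → ℂ} (h : Nondegenerate τ η z) (c : Fin n → ℕ)
    (m : ℕ) : levelE τ η z c m ≠ 0 := by
  refine prod_ne_zero_iff.2 fun i _ => prod_ne_zero_iff.2 fun k _ => ?_
  split_ifs
  · exact h.2 _ _
  · exact one_ne_zero

lemma levelQ_ne_zero {n : ℕ} {τ η : ℂ} {z : Fin n → ℂ} (h : Nondegenerate τ η z) (c : Fin n → ℕ)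
    (m : ℕ) : levelQ τ η z c m ≠ 0 := by
  refine prod_ne_zero_iff.2 fun i _ => prod_ne_zero_iff.2 fun k _ => ?_
  split_ifs
  · exact h.2 _ _
  · exact one_ne_zero

lemma levelQ_zero_ne_zero {n : ℕ} {τ η : ℂ} {z : Fin n → ℂ} (h : Nondegenerate τ η z)
    (c : Fin n → ℕ) (m : ℕ) : levelQ τ 0 z c m ≠ 0 := by
  refine prod_ne_zero_iff.2 fun i _ => prod_ne_zero_iff.2 fun k _ => ?_
  split_ifs with hc
  · rw [zero_add]
    exact h.1 _ _ (by rintro rfl; omega)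
  · exact one_ne_zero

/-- The orthogonality relation for the partition into successive intervals. -/
lemma pairing_of_monotone {τ η : ℂ} {ν : Fin N → ℂ} (hg : Generic τ η (extendDyn ν) N)
    {z : Fin (total lam) → ℂ} (hz : Nondegenerate τ η z) {J : Part lam} (hJ : Monotone J.color)
    (K : Part lam) : pairing τ η ν J K z = if J = K then 1 else 0 := by
  unfold pairing
  rw [sum_eq_single J]
  rotate_left
  · intro I _ hI
    rw [weight_valuesAt_top τ η _ z (Or.inl hJ) J.color_lt I.color_lt,
      if_neg fun h => hI (color_injective h).symm]
    ring
  · simp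
  have hanti : Antitone (J.color ∘ Fin.revPerm) := fun i k hik => hJ (Fin.rev_le_rev.2 hik)
  rw [weight_valuesAt_top τ η _ z (Or.inl hJ) J.color_lt J.color_lt, if_pos rfl,
    ← weight_valuesAt_comp τ η _ z J.color Fin.revPerm,
    weight_valuesAt_top τ η _ _ (c := K.color ∘ Fin.revPerm) (Or.inr hanti)
      (fun i => K.color_lt _) (fun i => J.color_lt _)]
  by_cases hJK : J = K
  swap
  · rw [if_neg hJK, if_neg]
    · ring
    · intro h
      apply hJK
      apply color_injective
      funext i
      have := congrFun h (Fin.revPerm i)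
      simpa using this.symm
  subst hJK
  rw [if_pos rfl, if_pos rfl, normFactor, ← prod_mul_distrib, ← prod_mul_distrib]
  refine prod_eq_one fun m hm => ?_
  rw [mem_range] at hm
  have h1 := pow_mul_levelFactor hg hz.1 (c := J.color) hm 0 (fun i k hi hk =>
    ⟨fun hki => absurd (hJ hki.le) (by omega), fun _ => rfl⟩)
  have h2 := pow_mul_levelFactor (hg.dual (lam := lam)) (hz.comp Fin.revPerm).1
    (c := J.color ∘ Fin.revPerm) hm η (fun i k hi hk =>
    ⟨fun _ => rfl, fun hik => absurd (hanti hik.le) (by omega)⟩)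
  rw [levelE_comp, levelQ_comp, card_comp_lt] at h2
  have n1 := levelE_ne_zero hz J.color m
  have n2 := levelQ_ne_zero hz J.color m
  have n3 := levelQ_zero_ne_zero hz J.color m
  rw [mul_div_assoc', div_eq_one_iff_eq (by positivity)]
  linear_combination (theta τ η ^ #{i | J.color i < m} * levelFactor τ η
    (extendDyn (dualDyn lam η ν)) (J.color ∘ Fin.revPerm) m (z ∘ Fin.revPerm)
      (z ∘ Fin.revPerm)) * h1 + levelE τ η z J.color m * levelQ τ 0 z J.color m * h2

end EllipticWeight

namespace EllipticWeight

variable {N : ℕ} {lam : Fin N → ℕ} {τ η : ℂ} {ν : Fin N → ℂ}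

lemma color_permInv (σ : Equiv.Perm (Fin (total lam))) (I : Part lam) :
    (permInv σ I).color = I.color ∘ σ := rfl

lemma permInv_swap_permInv_swap (a a' : Fin (total lam)) (I : Part lam) :
    permInv (Equiv.swap a a') (permInv (Equiv.swap a a') I) = I :=
  color_injective (comp_swap_comp_swap I.color)

lemma valuesAt_sub_ne_zero {n : ℕ} {z : Fin n → ℂ} (hz : Nondegenerate τ η z) (I : Fin n → ℕ)
    (m : ℕ) (x y : {i // I i < m}) (hxy : x ≠ y) :
    theta τ (valuesAt z I m y - valuesAt z I m x) ≠ 0 :=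
  hz.1 _ _ fun h => hxy (Subtype.ext h)

lemma revPerm_comp_swap {α : Type*} {n : ℕ} (a a' : Fin n) (f : Fin n → α) :
    (f ∘ Equiv.swap a a') ∘ Fin.revPerm =
      (f ∘ Fin.revPerm) ∘ Equiv.swap (Fin.revPerm a') (Fin.revPerm a) := by
  funext i
  simp only [Function.comp_apply]
  congr 1
  by_cases h1 : i = Fin.rev a
  · subst h1; simp
  by_cases h2 : i = Fin.rev a'
  · subst h2; simp
  have h3 : Fin.revPerm i ≠ a := fun h => h1 (by rw [← h]; simp)
  have h4 : Fin.revPerm i ≠ a' := fun h => h2 (by rw [← h]; simp)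
  rw [Equiv.swap_apply_of_ne_of_ne h3 h4]
  exact (congrArg Fin.revPerm (Equiv.swap_apply_of_ne_of_ne h2 h1)).symm

/-- The dynamical variables of the reversed coloring, with the dual parameters, are those of the
coloring itself up to a sign and a shift. -/
lemma dynVar_dual {a a' : Fin (total lam)} (h : a < a') (hadj : ∀ k, a < k → ¬k < a')
    (J : Part lam) (l : Fin N) :
    dynVar η (extendDyn (dualDyn lam η ν)) (J.color ∘ Fin.revPerm) (Fin.revPerm a') l =
      -dynVar η (extendDyn ν) J.color a l -
        ((if J.color a = l then 1 else 0) + (if J.color a' = l then 1 else 0)) * η := by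
  have h1 := colorCount_add_rev J.color l a'
  rw [colorCount_snd h hadj] at h1
  have h2 : #{b | J.color b = l} = lam l := by
    rw [← J.2 l]
    congr 1
    ext b
    simp only [mem_filter, mem_univ, true_and]
    simp only [Part.color, Fin.ext_iff]
  rw [h2] at h1
  have h3 := congrArg (Nat.cast : ℕ → ℂ) h1
  push_cast at h3
  simp only [dynVar, extendDyn_val, dualDyn]
  linear_combination η * h3

/-- The induction step: from a partition to the one obtained by exchanging two neighbouring
elements in increasing blocks. -/
lemma pairing_permInv_swap (hτ : 0 < τ.im) (hg : Generic τ η (extendDyn ν) N)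
    {z : Fin (total lam) → ℂ} (hz : Nondegenerate τ η z) {J : Part lam}
    (hJ : ∀ K z, Nondegenerate τ η z → pairing τ η ν J K z = if J = K then 1 else 0)
    {a a' : Fin (total lam)} (h : a < a') (hadj : ∀ k, a < k → ¬k < a')
    (hlt : J.color a < J.color a') (K : Part lam) :
    pairing τ η ν (permInv (Equiv.swap a a') J) K z =
      if permInv (Equiv.swap a a') J = K then 1 else 0 := by
  have hη : theta τ η ≠ 0 := by simpa using hz.2 a a
  set s := Equiv.swap a a' with hs
  set u := z a' - z a with hu
  set α := alphaCoeff τ η (dynVar η (extendDyn ν) J.color a (J.color a) -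
    dynVar η (extendDyn ν) J.color a (J.color a')) u with hα
  -- The weight functions `W_K` at the exchanged variables, summed against those of `J`.
  set M := ∑ I : Part lam, weight τ η (extendDyn ν) (valuesAt (z ∘ s) I.color) J.color N (z ∘ s) *
    weight τ η (extendDyn (dualDyn lam η ν)) (valuesAt (z ∘ s) I.color) (K.color ∘ Fin.revPerm) N
      (z ∘ Fin.revPerm) * normFactor τ η N (z ∘ s) I.color with hM
  have hzs : (z ∘ s) ∘ s = z := comp_swap_comp_swap z
  have step : pairing τ η ν (permInv s J) K z =
      α * pairing τ η ν J K z + betaCoeff τ η u * M := by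
    have hMz : M = ∑ I : Part lam, weight τ η (extendDyn ν) (valuesAt z I.color) J.color N (z ∘ s) *
        weight τ η (extendDyn (dualDyn lam η ν)) (valuesAt z I.color) (K.color ∘ Fin.revPerm) N
          (z ∘ Fin.revPerm) * normFactor τ η N z I.color := by
      let e : Part lam ≃ Part lam := ⟨permInv s, permInv s, permInv_swap_permInv_swap a a',
        permInv_swap_permInv_swap a a'⟩
      rw [hM, ← e.sum_comp]
      refine sum_congr rfl fun I _ => ?_
      change weight _ _ _ (valuesAt (z ∘ s) (I.color ∘ s)) _ _ _ *
        weight _ _ _ (valuesAt (z ∘ s) (I.color ∘ s)) _ _ _ * normFactor _ _ _ _ (I.color ∘ s) = _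
      rw [weight_valuesAt_comp, weight_valuesAt_comp, normFactor_comp]
    rw [hMz]
    unfold pairing
    rw [mul_sum, mul_sum, ← sum_add_distrib]
    refine sum_congr rfl fun I _ => ?_
    rw [color_permInv, weight_exchange hτ hg (valuesAt_sub_ne_zero hz I.color) h hadj hlt
      (J.color_lt a') le_rfl (hz.1 a a' h.ne)]
    ring
  rw [step, hJ K z hz]
  have hz' : Nondegenerate τ η (z ∘ s) := hz.comp s
  have hg' := hg.dual (lam := lam)
  -- The reversed positions of the two elements.
  set b := Fin.revPerm a' with hb
  set b' := Fin.revPerm a with hb'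
  have hbb : b < b' := Fin.rev_lt_rev.2 h
  have hbadj : ∀ k, b < k → ¬k < b' := by
    intro k h1 h2
    refine hadj (Fin.rev k) ?_ ?_
    · exact Fin.lt_rev_iff.2 h2
    · exact Fin.rev_lt_iff.2 h1
  have hrev : z ∘ Fin.revPerm = ((z ∘ s) ∘ Fin.revPerm) ∘ Equiv.swap b b' := by
    rw [hb, hb', ← revPerm_comp_swap, ← hs, hzs]
  have hC : (K.color ∘ Fin.revPerm) ∘ Equiv.swap b b' = (permInv s K).color ∘ Fin.revPerm := by
    rw [hb, hb', ← revPerm_comp_swap, color_permInv]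
  set C := K.color ∘ Fin.revPerm with hCdef
  have hCb : C b = K.color a' := by simp [hCdef, hb]
  have hCb' : C b' = K.color a := by simp [hCdef, hb']
  set T := (z ∘ s) ∘ Fin.revPerm with hTdef
  have hTu : T b' - T b = u := by simp [hTdef, hb, hb', hs, hu]
  have hTne : theta τ (T b' - T b) ≠ 0 := by rw [hTu]; exact hz.1 a a' h.ne
  have hTne' : theta τ (T b' - T b - η) ≠ 0 := by rw [hTu]; exact hz.neg_shift_ne_zero a a'
  by_cases hK : K.color a = K.color a'
  · have hMp : M = pairing τ η ν J K (z ∘ s) := by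
      rw [hM, hrev]
      refine sum_congr rfl fun I _ => ?_
      rw [weight_symm hτ hg' hη (valuesAt_sub_ne_zero hz' I.color)
        (fun m x y _ => hz'.neg_shift_ne_zero _ _) hbb hbadj (by rw [hCb, hCb', hK]) le_rfl
        hTne hTne']
    rw [hMp, hJ K _ hz', if_neg, if_neg]
    · ring
    · rintro rfl
      simp only [color_permInv, Function.comp_apply, hs, Equiv.swap_apply_left,
        Equiv.swap_apply_right] at hK
      omega
    · rintro rfl
      omega
  · have hMp : betaCoeff τ η u * M =
        kappaCoeff τ η (dynVar η (extendDyn (dualDyn lam η ν)) C b (C b) -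
          dynVar η (extendDyn (dualDyn lam η ν)) C b (C b')) u (C b < C b') *
            pairing τ η ν J (permInv s K) (z ∘ s) -
        alphaCoeff τ η (dynVar η (extendDyn (dualDyn lam η ν)) C b (C b) -
          dynVar η (extendDyn (dualDyn lam η ν)) C b (C b')) u * pairing τ η ν J K (z ∘ s) := by
      rw [hM, hrev]
      unfold pairing
      rw [mul_sum, mul_sum, mul_sum, ← sum_sub_distrib]
      refine sum_congr rfl fun I _ => ?_
      have key := betaCoeff_mul_weight_comp_swap hτ hg' (valuesAt_sub_ne_zero hz' I.color) hbb
        hbadj (c := C) (by rw [hCb, hCb']; exact Ne.symm hK) (K.color_lt _) (K.color_lt _) hTne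
      rw [hTu, hC] at key
      linear_combination weight τ η (extendDyn ν) (valuesAt (z ∘ s) I.color) J.color N (z ∘ s) *
        normFactor τ η N (z ∘ s) I.color * key
    rw [hMp, hJ _ _ hz', hJ _ _ hz']
    have hsJ : permInv s J = K ↔ J = permInv s K := by
      constructor
      · rintro rfl; exact (permInv_swap_permInv_swap a a' J).symm
      · rintro rfl; exact permInv_swap_permInv_swap a a' K
    by_cases h1 : J = K
    · subst h1
      have h2 : ¬J = permInv s J := by
        intro h2
        have := congrFun (congrArg Part.color h2) a
        simp only [color_permInv, Function.comp_apply, hs, Equiv.swap_apply_left] at this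
        omega
      rw [if_pos rfl, if_neg h2, if_neg (fun h3 => h2 (hsJ.1 h3)), hCb, hCb']
      have d1 := dynVar_dual (η := η) (ν := ν) h hadj J (J.1 a)
      have d2 := dynVar_dual (η := η) (ν := ν) h hadj J (J.1 a')
      have c1 : ((J.1 a : Fin N) : ℕ) = J.color a := rfl
      have c2 : ((J.1 a' : Fin N) : ℕ) = J.color a' := rfl
      rw [c1, ← hb, ← hCdef, if_pos rfl, if_neg hlt.ne'] at d1
      rw [c2, ← hb, ← hCdef, if_pos rfl, if_neg hlt.ne] at d2
      have hD : dynVar η (extendDyn (dualDyn lam η ν)) C b (J.color a') -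
          dynVar η (extendDyn (dualDyn lam η ν)) C b (J.color a) =
          dynVar η (extendDyn ν) J.color a (J.color a) -
            dynVar η (extendDyn ν) J.color a (J.color a') := by
        rw [d1, d2]; ring
      rw [hD]
      ring
    · rw [if_neg h1]
      by_cases h2 : J = permInv s K
      · have hlt' : C b < C b' := by
          rw [hCb, hCb']
          rw [h2] at hlt
          simpa [color_permInv, hs] using hlt
        rw [if_pos h2, if_pos (hsJ.2 h2), kappaCoeff, if_pos hlt']
        ring
      · rw [if_neg h2, if_neg (fun h3 => h2 (hsJ.1 h3))]
        ring

lemma monotone_of_neighbours {n : ℕ} {c : Fin n → ℕ}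
    (h : ∀ a a' : Fin n, a'.val = a.val + 1 → c a ≤ c a') : Monotone c := by
  suffices hd : ∀ (d : ℕ) (i k : Fin n), k.val = i.val + d → c i ≤ c k from
    fun i k hik => hd (k.val - i.val) i k (by have : i.val ≤ k.val := hik; omega)
  intro d
  induction d with
  | zero => intro i k hk; rw [Fin.ext (a := k) (b := i) (by omega)]
  | succ d ih =>
    intro i k hk
    exact (ih i ⟨i.val + d, by omega⟩ rfl).trans (h _ _ (by simp; omega))

/-- The orthogonality relation for generic dynamical parameters, by induction from the partition
into successive intervals. -/
theorem pairing_eq (hτ : 0 < τ.im) (hg : Generic τ η (extendDyn ν) N) (J : Part lam) :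
    ∀ (K : Part lam) (z : Fin (total lam) → ℂ), Nondegenerate τ η z →
      pairing τ η ν J K z = if J = K then 1 else 0 := by
  -- The weight decreases when a larger label is moved to a later position.
  induction hk : ∑ i, (total lam - i.val) * J.color i using Nat.strong_induction_on
    generalizing J with
  | _ k ih =>
  by_cases hmono : ∀ a a' : Fin (total lam), a'.val = a.val + 1 → J.color a ≤ J.color a'
  · exact fun K z hz => pairing_of_monotone hg hz (monotone_of_neighbours hmono) K
  · push Not at hmono
    obtain ⟨a, a', haa', hlt⟩ := hmono
    have h : a < a' := by rw [Fin.lt_def]; omega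
    have hadj : ∀ k, a < k → ¬k < a' := by
      intro k h1 h2
      rw [Fin.lt_def] at h1 h2
      omega
    have hswap := permInv_swap_permInv_swap a a' J
    intro K z hz
    rw [← hswap]
    refine pairing_permInv_swap hτ hg hz (ih _ ?_ _ rfl) h hadj ?_ K
    · rw [← hk]
      have hpair : ∑ i, (((total lam - i.val : ℕ) : ℤ) * J.color i -
          ((total lam - i.val : ℕ) : ℤ) * J.color (Equiv.swap a a' i)) =
          (J.color a : ℤ) - J.color a' := by
        rw [sum_eq_add a a' h.ne]
        · rw [Equiv.swap_apply_left, Equiv.swap_apply_right]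
          have hw : ((total lam - a.val : ℕ) : ℤ) = ((total lam - a'.val : ℕ) : ℤ) + 1 := by
            have := a'.isLt
            omega
          rw [hw]
          ring
        · rintro i - ⟨h1, h2⟩
          rw [Equiv.swap_apply_of_ne_of_ne h1 h2, sub_self]
        · simp
        · simp
      rw [sum_sub_distrib] at hpair
      zify
      simp only [color_permInv, Function.comp_apply]
      have : (J.color a' : ℤ) < J.color a := by exact_mod_cast hlt
      linarith
    · simpa [color_permInv] using hlt

/-! ### Arbitrary dynamical parameters -/

/-- Generic parameters are dense on the line `ν_l + ε l`. -/
lemma dense_generic (hτ : 0 < τ.im) (η : ℂ) (ν : Fin N → ℂ) :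
    Dense {ε : ℂ | Generic τ η (extendDyn fun l => ν l + ε * l.val) N} := by
  have hcount : (⋃ (r : ℤ) (l : Fin N) (l' : Fin N) (_ : l ≠ l'),
      (fun ε : ℂ => r * η + (ν l + ε * l.val) - (ν l' + ε * l'.val)) ⁻¹'
        {u | theta τ u = 0}).Countable := by
    refine Set.countable_iUnion fun r => Set.countable_iUnion fun l => Set.countable_iUnion fun l' =>
      Set.countable_iUnion fun hl => (countable_theta_zeros hτ).preimage ?_
    intro x y hxy
    have hne : (l.val : ℂ) - l'.val ≠ 0 := by
      rw [sub_ne_zero]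
      exact fun h => hl (Fin.ext (Nat.cast_injective h))
    apply mul_right_cancel₀ hne
    simp only at hxy
    linear_combination hxy
  refine (hcount.dense_compl ℂ).mono fun ε hε => ?_
  intro r l l' hl hl' hne h0
  apply hε
  simp only [Set.mem_iUnion]
  refine ⟨r, ⟨l, hl⟩, ⟨l', hl'⟩, fun h => hne (congrArg Fin.val h), ?_⟩
  simpa [extendDyn, hl, hl'] using h0

lemma continuous_dynArg (I : Part lam) (η : ℂ) {f : ℂ → Fin N → ℂ} (hf : Continuous f)
    (k : Fin (N - 1)) (a : Fin (cum lam (k + 1))) : Continuous fun ε => dynArg I η (f ε) k a := by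
  unfold dynArg
  fun_prop

/-- The weight functions depend continuously on the dynamical parameters away from the zeros of
the denominators. -/
lemma continuousAt_W (hτ : 0 < τ.im) (I : Part lam) (t : TVar lam) (z : Fin (total lam) → ℂ)
    (η : ℂ) {f : ℂ → Fin N → ℂ} (hf : Continuous f) {ε₀ : ℂ} (h0 : psiDenom τ I η (f ε₀) ≠ 0) :
    ContinuousAt (fun ε => W τ I t z η (f ε)) ε₀ := by
  have hd : ∀ k a, theta τ (dynArg I η (f ε₀) k a) ≠ 0 := fun k a =>
    prod_ne_zero_iff.1 (prod_ne_zero_iff.1 h0 k (mem_univ _)) a (mem_univ _)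
  have hc := continuous_theta hτ
  unfold W
  refine continuousAt_const.mul (tendsto_finsetSum _ fun s _ => ?_)
  unfold U
  refine tendsto_finsetProd _ fun k _ => tendsto_finsetProd _ fun a _ =>
    Tendsto.mul (tendsto_finsetProd _ fun c _ => ?_) tendsto_const_nhds
  have hcd := continuous_dynArg I η hf k a
  unfold psi
  split_ifs
  · exact tendsto_const_nhds
  · exact ((hc.comp (continuous_const.add hcd)).continuousAt).div (hc.comp hcd).continuousAt
      (hd k a)
  · exact tendsto_const_nhds

end EllipticWeight

end

/-- Orthogonality relation for the elliptic weight functions.  The permutation `Fin.revPerm` is the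
longest element `σ₀` of the symmetric group.  The hypotheses on `z`, `η`, `ν` say that the
denominators of the formula do not vanish. -/
theorem theorem2p9 {N : ℕ} (lam : Fin N → ℕ) (τ : ℂ) (hτ : 0 < τ.im)
    (z : Fin (EllipticWeight.total lam) → ℂ) (η : ℂ) (ν : Fin N → ℂ)
    (J K : EllipticWeight.Part lam)
    (hz : ∀ a b, a ≠ b → EllipticWeight.theta τ (z b - z a) ≠ 0)
    (hη : ∀ a b, EllipticWeight.theta τ (η + z b - z a) ≠ 0)
    (hJ : EllipticWeight.psiDenom τ J η ν ≠ 0)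
    (hK : EllipticWeight.psiDenom τ (EllipticWeight.permInv Fin.revPerm K) η
      (EllipticWeight.dualDyn lam η ν) ≠ 0) :
    ∑ I : EllipticWeight.Part lam,
        EllipticWeight.Wtilde τ 1 J (EllipticWeight.zSub z I) z η ν *
          EllipticWeight.Wtilde τ Fin.revPerm K (EllipticWeight.zSub z I) z η
            (EllipticWeight.dualDyn lam η ν) /
          (EllipticWeight.R τ z I * EllipticWeight.Q τ z η I) =
      if J = K then 1 else 0 := by
  open EllipticWeight in
  -- The relation holds for generic parameters on the line `ν_l + ε l`, and both sides are
  -- continuous at `ε = 0`.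
  let f : ℂ → Fin N → ℂ := fun ε l => ν l + ε * l.val
  have hf : Continuous f := by fun_prop
  have hf' : Continuous fun ε => dualDyn lam η (f ε) := by unfold dualDyn; fun_prop
  have hf0 : f 0 = ν := by funext l; simp [f]
  have hcont : ContinuousAt (fun ε => ∑ I : Part lam,
      Wtilde τ 1 J (zSub z I) z η (f ε) *
        Wtilde τ Fin.revPerm K (zSub z I) z η (dualDyn lam η (f ε)) / (R τ z I * Q τ z η I)) 0 := by
    refine tendsto_finsetSum _ fun I _ => ?_
    refine Filter.Tendsto.div_const (Filter.Tendsto.mul (Filter.Tendsto.div_const ?_ _)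
      (Filter.Tendsto.div_const ?_ _)) _
    · exact continuousAt_W hτ _ _ _ η hf (by rw [hf0]; exact hJ)
    · exact continuousAt_W hτ _ _ _ η hf' (by rw [hf0]; exact hK)
  have hgen : ∀ ε ∈ {ε : ℂ | Generic τ η (extendDyn (f ε)) N}, (∑ I : Part lam,
      Wtilde τ 1 J (zSub z I) z η (f ε) *
        Wtilde τ Fin.revPerm K (zSub z I) z η (dualDyn lam η (f ε)) / (R τ z I * Q τ z η I)) =
      if J = K then 1 else 0 := fun ε hε => by
    rw [sum_Wtilde_eq_pairing]
    exact pairing_eq hτ hε J K z ⟨hz, hη⟩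
  have hmem := (dense_generic hτ η ν) 0
  rw [mem_closure_iff_nhdsWithin_neBot] at hmem
  have h1 := hcont.tendsto.mono_left (nhdsWithin_le_nhds
    (s := {ε : ℂ | Generic τ η (extendDyn (f ε)) N}))
  have h2 := tendsto_nhds_unique_of_eventuallyEq h1 tendsto_const_nhds
    (eventually_nhdsWithin_of_forall hgen)
  rw [hf0] at h2
  exact h2
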